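/- **Setting.** For $n,N\in\mathbb N_+$, $\beta\ge 0$ and $\rho\in(0,1]$, let $\mathcal X_n^\rho$ be the sparse Rademacher prior: the law of $x\in\mathbb R^n$ with i.i.d. entries equal to $\pm 1/\sqrt{\rho n}$ with probability $\rho/2$ each and to $0$ with probability $1-\rho$. In the spiked Wishart model, under $\mathbb P$ one draws $x\sim\mathcal X_n^\rho$ and then $N$ independent samples $y^{(1)},\dots,y^{(N)}\sim\mathcal N(0,I_n+\beta xx^\top)$; under $\mathbb Q$ one observes $N$ independent samples from $\mathcal N(0,I_n)$. Let $L=d\mathbb P/d\mathbb Q$, and let $L^{\le D}=L^{\le D}_{n,N,\beta,\mathcal X}$ be the orthogonal projection of $L$, with respect to $\langle f,g\rangle=\mathbb E_{\mathbb Q}[fg]$, onto the polynomials of total degree at most $D$ in the $nN$ data entries, i.e. the polynomial of degree at most $D$ such that $L-L^{\le D}$ is orthogonal to all such polynomials ($L$ itself need not be in $L^2(\mathbb Q)$). Let $\|L^{\le D}\|=\mathbb E_{\mathbb Q}[(L^{\le D})^2]^{1/2}$, $\gamma=n/N$ and $\hat\lambda=\beta/\sqrt\gamma$. **Theorem (Boundedness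 of the low-degree likelihood ratio for large $\rho$, Wishart model).** Let $N_n\in\mathbb N_+$, $\beta_n\ge 0$, $\rho_n\in(0,1]$ and $D_n\in\mathbb N$ depend on $n$, with $\gamma_n=n/N_n=O(1)$ (for instance, $\gamma_n$ convergent) and $D_n=o(n)$. Suppose that one of the following holds: (a) $\limsup_{n\to\infty}\hat\lambda_n<1$ and, for all sufficiently large $n$, $$\rho_n\ \ge\ \max\left(1,\sqrt{\frac{1}{6\log(1/\hat\lambda_n)}}\right)\sqrt{\frac{D_n}{n}}$$ (where $\frac{1}{6\log(1/\hat\lambda_n)}$ is read as $0$ if $\hat\lambda_n=0$); or (b) $\limsup_{n\to\infty}\hat\lambda_n<1/\sqrt3$ and, for all sufficiently large $n$, $$\rho_n\ \ge\ \hat\lambda_n\sqrt{\frac{D_n}{n}}.$$ Then, for every $n\ge1$, $\mathbb P\ll\mathbb Q$ and the projection $L^{\le D_n}$ exists, and $\|L^{\le D_n}_{n,N_n,\beta_n,\mathcal X}\|=O(1)$ as $n\to\infty$. -/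

import Mathlib

open MeasureTheory ProbabilityTheory Filter Asymptotics

noncomputable section

namespace SparsePCA

/-- The law of one entry of a sparse Rademacher vector in dimension `n` with sparsity `ρ`:
`± 1 / √(ρ n)` with probability `ρ / 2` each, and `0` with probability `1 - ρ`. -/
def sparseRademacherEntry (n : ℕ) (ρ : ℝ) : Measure ℝ :=
  ENNReal.ofReal (ρ / 2) • Measure.dirac (1 / √(ρ * n))
    + ENNReal.ofReal (ρ / 2) • Measure.dirac (-(1 / √(ρ * n)))
    + ENNReal.ofReal (1 - ρ) • Measure.dirac 0

/-- The sparse Rademacher prior: `n` i.i.d. entries. -/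
def sparseRademacher (n : ℕ) (ρ : ℝ) : Measure (Fin n → ℝ) :=
  Measure.pi fun _ => sparseRademacherEntry n ρ

/-- The data of the Wishart model: `N` samples in `ℝⁿ`. -/
abbrev WishartData (n N : ℕ) : Type := Fin N → EuclideanSpace ℝ (Fin n)

/-- `N` independent samples from `𝒩(0, Iₙ + β x xᵀ)`, for a fixed spike `x`. -/
def wishartSpike (n N : ℕ) (β : ℝ) (x : Fin n → ℝ) : Measure (WishartData n N) :=
  Measure.pi fun _ => multivariateGaussian 0 (1 + β • Matrix.vecMulVec x x)

/-- The planted distribution: draw `x` from the prior `X`, then `N` independent samples from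
`𝒩(0, Iₙ + β x xᵀ)`. -/
def wishartPlanted (n N : ℕ) (β : ℝ) (X : Measure (Fin n → ℝ)) : Measure (WishartData n N) :=
  X.bind (wishartSpike n N β)

/-- The null distribution: `N` independent samples from `𝒩(0, Iₙ)`. -/
def wishartNull (n N : ℕ) : Measure (WishartData n N) :=
  Measure.pi fun _ => multivariateGaussian 0 1

/-- The likelihood ratio `dP/dQ` of the planted against the null distribution. -/
def likelihoodRatio (n N : ℕ) (β : ℝ) (X : Measure (Fin n → ℝ)) : WishartData n N → ℝ :=
  fun y => ((wishartPlanted n N β X).rnDeriv (wishartNull n N) y).toReal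

/-- The polynomial functions of total degree at most `D` in the `N * n` entries of the data. -/
def polysOfDegreeLE (n N D : ℕ) : Set (WishartData n N → ℝ) :=
  {f | ∃ p : MvPolynomial (Fin N × Fin n) ℝ, p.totalDegree ≤ D ∧
    ∀ y, f y = MvPolynomial.eval (fun ij => y ij.1 ij.2) p}

/-- `g` is the orthogonal projection of `f` onto `V` for the inner product
`⟨f, g⟩ = ∫ f g dQ`: `g` is an element of `V` that lies in `L²(Q)`, and `f - g` is orthogonal to
every element of `V`. The function `f` itself is not required to lie in `L²(Q)`; it suffices
that its inner products with the elements of `V` exist. -/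
def IsOrthogonalProjection {Ω : Type*} [MeasurableSpace Ω] (Q : Measure Ω) (V : Set (Ω → ℝ))
    (f g : Ω → ℝ) : Prop :=
  g ∈ V ∧ MemLp g 2 Q ∧
    ∀ h ∈ V, Integrable (fun y => (f y - g y) * h y) Q ∧ ∫ y, (f y - g y) * h y ∂Q = 0

open Classical in
/-- The orthogonal projection of `f` onto `V` (and `0` if there is none). -/
def orthogonalProjection {Ω : Type*} [MeasurableSpace Ω] (Q : Measure Ω) (V : Set (Ω → ℝ))
    (f : Ω → ℝ) : Ω → ℝ :=
  if h : ∃ g, IsOrthogonalProjection Q V f g then h.choose else 0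

/-- The degree-`D` likelihood ratio: the projection of the likelihood ratio onto the polynomials
of degree at most `D`. -/
def lowDegreeLR (n N : ℕ) (β : ℝ) (X : Measure (Fin n → ℝ)) (D : ℕ) : WishartData n N → ℝ :=
  orthogonalProjection (wishartNull n N) (polysOfDegreeLE n N D) (likelihoodRatio n N β X)

/-- The norm of the degree-`D` likelihood ratio in `L²` of the null distribution. -/
def lowDegreeLRNorm (n N : ℕ) (β : ℝ) (X : Measure (Fin n → ℝ)) (D : ℕ) : ℝ :=
  √(∫ y, lowDegreeLR n N β X D y ^ 2 ∂(wishartNull n N))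

/-- The signal-to-noise ratio `β / √γ`, where `γ = n / N`. -/
def snr (n N : ℕ) (β : ℝ) : ℝ := β / √((n : ℝ) / N)

end SparsePCA

end

noncomputable section

namespace SparsePCA

/-! A planted sample is `z + √β g x` with standard Gaussian noise `z` and an independent standard
Gaussian latent variable `g`. Since `E H_a(z + w) = w ^ a`, the planted mean of a Hermite product is
a moment of the signal `√β g xᵀ`. By absolute continuity these means are the Hermite coefficients of
the likelihood ratio, so the projection is an explicit finite sum and no second moment of the ratio
is needed. Its squared norm is a sum of squared signal moments over factorials. Writing each square
with two independent replicas and applying the multinomial theorem gives `∑_{d ≤ D} β^d / d! ·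
E⟨x,x'⟩^d · E⟨g,g'⟩^d` (`integral_lowDegreeLR_sq_eq_sum`).

It remains to bound each degree by a geometric term. Both overlap moments are controlled by
exponential moments, which factor over coordinates (`abs_overlapMoment_le`). With `1 / d! ≤ (e /
d)^d`, `λ` the signal-to-noise ratio and `m = ρ² n`, the degree-`d` term is at most `4 r^d`, where
`r² = λ² d / (t² m) · exp(1 / (1 - d/N) - 2 + 2 m (cosh t - 1) / d)` and `t > 0` is free
(`abs_degreeTerm_le`). As `D / N → 0`, the first two summands of the exponent are close to `-1`, and
`cosh t - 1 ≤ t²/2 + t⁴/12` for `|t| ≤ 1`. In case (a), `t² = d / m` gives `r² ≤ λ² exp(ε + d /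
(6m))`, and the sparsity condition bounds this by `λ exp ε`. In case (b), `t² = λ² d / m` removes
the prefactor and leaves an exponent of at most `-1/2 + ε`. -/

/-! ### Functions with moments of all orders -/

/-- `f` has finite moments of every order under `μ`. -/
def HasAllMoments {Ω : Type*} [MeasurableSpace Ω] (f : Ω → ℝ) (μ : Measure Ω) : Prop :=
  ∀ p : ℕ, MemLp f p μ

namespace HasAllMoments

variable {Ω Ω' : Type*} [MeasurableSpace Ω] [MeasurableSpace Ω'] {μ : Measure Ω}
  {μ' : Measure Ω'} {f g : Ω → ℝ}

lemma const [IsFiniteMeasure μ] (c : ℝ) : HasAllMoments (fun _ => c) μ :=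
  fun _ => memLp_const c

lemma add (hf : HasAllMoments f μ) (hg : HasAllMoments g μ) :
    HasAllMoments (fun x => f x + g x) μ :=
  fun p => (hf p).add (hg p)

/-- Hölder with exponents `2p, 2p` for order `p`. Products cost a factor of two in the order, so
only the class with all orders is closed under them. -/
lemma mul (hf : HasAllMoments f μ) (hg : HasAllMoments g μ) :
    HasAllMoments (fun x => f x * g x) μ := fun p => by
  have : ENNReal.HolderTriple ((2 * p : ℕ) : ENNReal) ((2 * p : ℕ) : ENNReal) (p : ENNReal) := by
    constructor
    rcases Nat.eq_zero_or_pos p with rfl | hp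
    · simp
    · push_cast
      rw [ENNReal.mul_inv (by simp) (by simp), ← add_mul, ENNReal.inv_two_add_inv_two, one_mul]
  exact MemLp.mul (hg (2 * p)) (hf (2 * p))

lemma pow [IsFiniteMeasure μ] (hf : HasAllMoments f μ) (k : ℕ) :
    HasAllMoments (fun x => f x ^ k) μ := by
  induction k with
  | zero => simpa using const 1
  | succ k ih => simpa [pow_succ] using ih.mul hf

lemma sum [IsFiniteMeasure μ] {ι : Type*} (s : Finset ι) {f : ι → Ω → ℝ}
    (hf : ∀ i ∈ s, HasAllMoments (f i) μ) : HasAllMoments (fun x => ∑ i ∈ s, f i x) μ := by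
  classical
  induction s using Finset.induction_on with
  | empty => simpa using const 0
  | insert a s ha ih =>
    simp only [Finset.sum_insert ha]
    exact (hf a (by simp)).add (ih fun i hi => hf i (by simp [hi]))

lemma prod [IsFiniteMeasure μ] {ι : Type*} (s : Finset ι) {f : ι → Ω → ℝ}
    (hf : ∀ i ∈ s, HasAllMoments (f i) μ) : HasAllMoments (fun x => ∏ i ∈ s, f i x) μ := by
  classical
  induction s using Finset.induction_on with
  | empty => simpa using const 1
  | insert a s ha ih =>
    simp only [Finset.prod_insert ha]
    exact (hf a (by simp)).mul (ih fun i hi => hf i (by simp [hi]))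

lemma integrable (hf : HasAllMoments f μ) : Integrable f μ := by
  have := hf 1
  rwa [Nat.cast_one, memLp_one_iff_integrable] at this

lemma comp (hf : HasAllMoments f μ) {φ : Ω' → Ω} (hφ : MeasurePreserving φ μ' μ) :
    HasAllMoments (fun x => f (φ x)) μ' :=
  fun p => (hf p).comp_measurePreserving hφ

lemma eval [IsFiniteMeasure μ] (hf : HasAllMoments f μ) (p : Polynomial ℝ) :
    HasAllMoments (fun x => p.eval (f x)) μ := by
  simp only [Polynomial.eval_eq_sum_range]
  exact sum _ fun i _ => (const _).mul (hf.pow i)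

lemma mvEval [IsFiniteMeasure μ] {κ : Type*} {f : κ → Ω → ℝ}
    (hf : ∀ k, HasAllMoments (f k) μ) (p : MvPolynomial κ ℝ) :
    HasAllMoments (fun x => MvPolynomial.eval (fun k => f k x) p) μ := by
  simp only [MvPolynomial.eval_eq]
  exact sum _ fun m _ => (const _).mul (prod _ fun k _ => (hf k).pow _)

end HasAllMoments

lemma hasAllMoments_gaussianReal (m : ℝ) (v : NNReal) :
    HasAllMoments (fun x => x) (gaussianReal m v) :=
  fun p => memLp_id_gaussianReal' p (by simp)

/-! ### Hermite polynomials -/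

/-- The standard Gaussian measure on the line. -/
abbrev stdNormal : Measure ℝ := gaussianReal 0 1

/-- The probabilists' Hermite polynomials with real coefficients. -/
def hermiteReal (n : ℕ) : Polynomial ℝ := (Polynomial.hermite n).map (Int.castRingHom ℝ)

lemma hermiteReal_zero : hermiteReal 0 = 1 := by simp [hermiteReal]

lemma hermiteReal_succ (n : ℕ) :
    hermiteReal (n + 1) = Polynomial.X * hermiteReal n - (hermiteReal n).derivative := by
  simp [hermiteReal, Polynomial.hermite_succ, Polynomial.derivative_map]

/-- Differentiating the recurrence and inserting the induction hypothesis leaves a multiple of the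
recurrence one degree lower. -/
lemma derivative_hermiteReal_succ (n : ℕ) :
    (hermiteReal (n + 1)).derivative = Polynomial.C ((n : ℝ) + 1) * hermiteReal n := by
  induction n with
  | zero => simp [hermiteReal_succ, hermiteReal_zero]
  | succ n ih =>
    have h := hermiteReal_succ n
    rw [hermiteReal_succ (n + 1), ih]
    simp only [Polynomial.derivative_sub, Polynomial.derivative_mul, Polynomial.derivative_X,
      Polynomial.derivative_C, ih]
    push_cast
    simp only [map_add, map_natCast, map_one] at ih ⊢
    linear_combination (-(n : Polynomial ℝ) - 1) * h

lemma natDegree_hermiteReal (n : ℕ) : (hermiteReal n).natDegree = n := by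
  rw [hermiteReal, (Polynomial.hermite_monic n).natDegree_map, Polynomial.natDegree_hermite]

/-- Hermite polynomials are monic of every degree, so subtracting a multiple of the top one lowers
the degree. -/
lemma exists_eq_sum_hermiteReal (a : ℕ) (p : Polynomial ℝ) (hp : p.natDegree ≤ a) :
    ∃ c : ℕ → ℝ, p = ∑ b ∈ Finset.range (a + 1), Polynomial.C (c b) * hermiteReal b := by
  induction a generalizing p with
  | zero =>
    refine ⟨fun _ => p.coeff 0, ?_⟩
    simpa [hermiteReal_zero] using Polynomial.eq_C_of_natDegree_le_zero hp
  | succ a ih =>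
    set q := p - Polynomial.C (p.coeff (a + 1)) * hermiteReal (a + 1) with hq
    have hlead : (hermiteReal (a + 1)).coeff (a + 1) = 1 := by
      rw [hermiteReal, Polynomial.coeff_map, Polynomial.coeff_hermite_self, map_one]
    have hqd : q.natDegree ≤ a := by
      rw [Polynomial.natDegree_le_iff_coeff_eq_zero]
      intro k hk
      rcases eq_or_lt_of_le (Nat.succ_le_of_lt hk) with rfl | hk'
      · simp [hq, hlead]
      · simp only [hq, Polynomial.coeff_sub, Polynomial.coeff_C_mul]
        rw [Polynomial.coeff_eq_zero_of_natDegree_lt (p := p) (by omega),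
          Polynomial.coeff_eq_zero_of_natDegree_lt (p := hermiteReal (a + 1))
            (by rw [natDegree_hermiteReal]; omega)]
        simp
    obtain ⟨c, hc⟩ := ih q hqd
    refine ⟨fun b => if b = a + 1 then p.coeff (a + 1) else c b, ?_⟩
    rw [Finset.sum_range_succ]
    have : ∑ b ∈ Finset.range (a + 1), Polynomial.C (if b = a + 1 then p.coeff (a + 1) else c b)
        * hermiteReal b = q := by
      rw [hc]
      refine Finset.sum_congr rfl fun b hb => ?_
      rw [if_neg (by have := Finset.mem_range.1 hb; omega)]
    rw [this]
    simp [hq]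

lemma integrable_eval_stdNormal (p : Polynomial ℝ) : Integrable (fun x => p.eval x) stdNormal :=
  ((hasAllMoments_gaussianReal 0 1).eval p).integrable

lemma hasDerivAt_gaussianPDFReal_std (x : ℝ) :
    HasDerivAt (gaussianPDFReal 0 1) (-x * gaussianPDFReal 0 1 x) x := by
  have h : HasDerivAt (fun x : ℝ => -(x - 0) ^ 2 / (2 * ((1 : NNReal) : ℝ))) (-x) x := by
    have := (((hasDerivAt_id x).sub_const 0).pow 2).neg.div_const (2 * ((1 : NNReal) : ℝ))
    refine this.congr_deriv ?_
    simp
    ring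
  have := h.exp.const_mul (√(2 * Real.pi * ((1 : NNReal) : ℝ)))⁻¹
  refine this.congr_deriv ?_
  rw [gaussianPDFReal]
  ring

lemma integrable_gaussianPDFReal_mul_eval (p : Polynomial ℝ) :
    Integrable (fun x => gaussianPDFReal 0 1 x * p.eval x) := by
  have h := integrable_eval_stdNormal p
  rw [stdNormal, gaussianReal_of_var_ne_zero _ one_ne_zero,
    integrable_withDensity_iff_integrable_smul' (measurable_gaussianPDF 0 1)
      (ae_of_all _ fun _ => gaussianPDF_lt_top)] at h
  simpa [toReal_gaussianPDF] using h

/-- Gaussian integration by parts. -/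
lemma integral_mul_eval_stdNormal (p : Polynomial ℝ) :
    ∫ x, x * p.eval x ∂stdNormal = ∫ x, p.derivative.eval x ∂stdNormal := by
  rw [integral_gaussianReal_eq_integral_smul one_ne_zero,
    integral_gaussianReal_eq_integral_smul one_ne_zero]
  simp only [smul_eq_mul]
  have h := integral_mul_deriv_eq_deriv_mul_of_integrable (u := fun x => p.eval x)
    (v := gaussianPDFReal 0 1) (u' := fun x => p.derivative.eval x)
    (v' := fun x => -x * gaussianPDFReal 0 1 x) (fun x _ => p.hasDerivAt x)
    (fun x _ => hasDerivAt_gaussianPDFReal_std x) ?_ ?_ ?_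
  · have e1 : ∀ x : ℝ, gaussianPDFReal 0 1 x * (x * p.eval x)
        = -(p.eval x * (-x * gaussianPDFReal 0 1 x)) := fun x => by ring
    simp_rw [e1, integral_neg, h, neg_neg, mul_comm]
  · refine (integrable_gaussianPDFReal_mul_eval (-Polynomial.X * p)).congr (ae_of_all _ fun x => ?_)
    simp
    ring
  · refine (integrable_gaussianPDFReal_mul_eval p.derivative).congr (ae_of_all _ fun x => ?_)
    simp [mul_comm]
  · refine (integrable_gaussianPDFReal_mul_eval p).congr (ae_of_all _ fun x => ?_)
    simp [mul_comm]

/-- The raising operator `p ↦ x p - p'` is the adjoint of differentiation under the Gaussian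
measure. Orthogonality follows by moving derivatives until one index reaches zero. -/
lemma integral_hermiteReal_succ_mul (a : ℕ) (q : Polynomial ℝ) :
    ∫ x, (hermiteReal (a + 1)).eval x * q.eval x ∂stdNormal
      = ∫ x, (hermiteReal a).eval x * q.derivative.eval x ∂stdNormal := by
  have e : ∀ x : ℝ, (hermiteReal (a + 1)).eval x * q.eval x
      = x * (hermiteReal a * q).eval x - ((hermiteReal a).derivative * q).eval x := fun x => by
    simp [hermiteReal_succ]
    ring
  have i1 : Integrable (fun x => x * (hermiteReal a * q).eval x) stdNormal :=
    (integrable_eval_stdNormal (Polynomial.X * (hermiteReal a * q))).congr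
      (ae_of_all _ fun x => by simp)
  simp_rw [e]
  rw [integral_sub i1 (integrable_eval_stdNormal _), integral_mul_eval_stdNormal,
    ← integral_sub (integrable_eval_stdNormal _) (integrable_eval_stdNormal _)]
  simp [Polynomial.derivative_mul]

lemma integral_hermiteReal_mul (a b : ℕ) :
    ∫ x, (hermiteReal a).eval x * (hermiteReal b).eval x ∂stdNormal
      = if a = b then (a.factorial : ℝ) else 0 := by
  induction a generalizing b with
  | zero =>
    cases b with
    | zero => simp [hermiteReal_zero]
    | succ b =>
      have := integral_hermiteReal_succ_mul b 1
      simpa [hermiteReal_zero] using this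
  | succ a ih =>
    cases b with
    | zero =>
      have := integral_hermiteReal_succ_mul a 1
      simpa [hermiteReal_zero] using this
    | succ b =>
      rw [integral_hermiteReal_succ_mul, derivative_hermiteReal_succ]
      have e : ∀ x : ℝ, (hermiteReal a).eval x
          * (Polynomial.C ((b : ℝ) + 1) * hermiteReal b).eval x
          = ((b : ℝ) + 1) * ((hermiteReal a).eval x * (hermiteReal b).eval x) := fun x => by
        simp
        ring
      simp_rw [e, integral_const_mul, ih]
      by_cases h : a = b
      · subst h
        simp [Nat.factorial_succ]
      · simp [h]

/-- Write the factor `x` of the recurrence as `z + w`. By Gaussian integration by parts the `z` part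
cancels the derivative, so each degree contributes one factor `w`. -/
lemma integral_hermiteReal_add (a : ℕ) (w : ℝ) :
    ∫ z, (hermiteReal a).eval (z + w) ∂stdNormal = w ^ a := by
  induction a with
  | zero => simp [hermiteReal_zero]
  | succ a ih =>
    set p := (hermiteReal a).comp (Polynomial.X + Polynomial.C w) with hp
    have e : ∀ z : ℝ, (hermiteReal (a + 1)).eval (z + w)
        = z * p.eval z + w * p.eval z - p.derivative.eval z := fun z => by
      simp [hermiteReal_succ, hp, Polynomial.derivative_comp]
      ring
    have i1 : Integrable (fun x => x * p.eval x) stdNormal :=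
      (integrable_eval_stdNormal (Polynomial.X * p)).congr (ae_of_all _ fun x => by simp)
    have i2 := (integrable_eval_stdNormal p).const_mul w
    have ep : ∀ z : ℝ, p.eval z = (hermiteReal a).eval (z + w) := fun z => by simp [hp]
    simp_rw [e]
    rw [integral_sub (show Integrable (fun z => z * p.eval z + w * p.eval z) stdNormal from
      i1.add i2) (integrable_eval_stdNormal _), integral_add i1 i2,
      integral_mul_eval_stdNormal, integral_const_mul]
    simp_rw [ep, ih]
    ring

/-! ### Absolute continuity of product measures -/

lemma absolutelyContinuous_pi_fin {n : ℕ} {E : Fin n → Type*} [∀ i, MeasurableSpace (E i)]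
    {μ ν : ∀ i, Measure (E i)} [∀ i, SigmaFinite (μ i)] [∀ i, SigmaFinite (ν i)]
    (h : ∀ i, μ i ≪ ν i) : Measure.pi μ ≪ Measure.pi ν := by
  induction n with
  | zero =>
    rw [Measure.pi_of_empty μ, Measure.pi_of_empty ν]
  | succ n ih =>
    rw [← ((measurePreserving_piFinSuccAbove μ 0).symm).map_eq,
      ← ((measurePreserving_piFinSuccAbove ν 0).symm).map_eq]
    exact ((h 0).prod (ih fun i => h _)).map (MeasurableEquiv.measurable _)

/-! ### The standard Gaussian measure on a Euclidean space -/

/-- The standard Gaussian measure on `ℝⁿ`. -/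
abbrev stdVec (n : ℕ) : Measure (EuclideanSpace ℝ (Fin n)) :=
  stdGaussian (EuclideanSpace ℝ (Fin n))

lemma integral_prod_stdVec {n : ℕ} (f : Fin n → ℝ → ℝ) :
    ∫ y, ∏ i, f i (y i) ∂(stdVec n) = ∏ i, ∫ u, f i u ∂stdNormal := by
  rw [stdVec, ← map_pi_eq_stdGaussian, ← integral_fintype_prod_eq_prod]
  exact integral_map_equiv (MeasurableEquiv.toLp 2 (Fin n → ℝ)) _

lemma measurePreserving_eval_stdVec {n : ℕ} (i : Fin n) :
    MeasurePreserving (fun y : EuclideanSpace ℝ (Fin n) => y i) (stdVec n) stdNormal := by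
  have := measurePreserving_eval_multivariateGaussian (μ := (0 : EuclideanSpace ℝ (Fin n)))
    (S := (1 : Matrix (Fin n) (Fin n) ℝ)) Matrix.PosSemidef.one (i := i)
  simpa using this

/-- Coordinatewise, a shifted and a centred Gaussian are both equivalent to Lebesgue measure. -/
lemma map_add_stdVec_absolutelyContinuous {n : ℕ} (v : EuclideanSpace ℝ (Fin n)) :
    (stdVec n).map (fun y => y + v) ≪ stdVec n := by
  rw [stdVec, ← map_pi_eq_stdGaussian, Measure.map_map (by fun_prop) (by fun_prop)]
  have e : (fun y : EuclideanSpace ℝ (Fin n) => y + v) ∘ (WithLp.toLp 2)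
      = (WithLp.toLp 2) ∘ fun (w : Fin n → ℝ) i => w i + v i := by
    ext w i
    simp
  rw [e, ← Measure.map_map (by fun_prop) (by fun_prop)]
  refine Measure.AbsolutelyContinuous.map ?_ (by fun_prop)
  have hm : ∀ i, stdNormal.map (fun u => u + v i) = gaussianReal (v i) 1 := fun i => by
    rw [gaussianReal_map_add_const, zero_add]
  have : ∀ i, SigmaFinite (stdNormal.map (fun u => u + v i)) := fun i => by
    rw [hm]; infer_instance
  rw [Measure.pi_map_pi (f := fun i u => u + v i) (fun i => by fun_prop)]
  refine absolutelyContinuous_pi_fin fun i => ?_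
  rw [hm]
  exact (gaussianReal_absolutelyContinuous _ one_ne_zero).trans
    (gaussianReal_absolutelyContinuous' _ one_ne_zero)

/-! ### Spiked Gaussian vectors -/

/-- Noise and latent variables of one sample of the Wishart model. -/
abbrev sampleSource (n : ℕ) : Measure (EuclideanSpace ℝ (Fin n) × ℝ) :=
  (stdVec n).prod stdNormal

/-- Compared through characteristic functions: the latent Gaussian contributes exactly the rank-one
term `β ⟨x, t⟩²` to the quadratic form. This realises the covariance without its matrix square root
and makes the spike an additive shift. -/
lemma multivariateGaussian_spike {n : ℕ} {β : ℝ} (hβ : 0 ≤ β) (x : Fin n → ℝ) :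
    multivariateGaussian 0 (1 + β • Matrix.vecMulVec x x)
      = (sampleSource n).map (fun p => p.1 + p.2 • WithLp.toLp 2 (√β • x)) := by
  have hS : (1 + β • Matrix.vecMulVec x x).PosSemidef :=
    Matrix.PosSemidef.one.add
      ((by simpa using Matrix.posSemidef_vecMulVec_self_star x :
        (Matrix.vecMulVec x x).PosSemidef).smul hβ)
  have : IsProbabilityMeasure
      ((sampleSource n).map (fun p => p.1 + p.2 • WithLp.toLp 2 (√β • x))) :=
    Measure.isProbabilityMeasure_map (by fun_prop)
  apply Measure.ext_of_charFun
  ext t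
  set v : EuclideanSpace ℝ (Fin n) := WithLp.toLp 2 (√β • x) with hv
  have h1 : charFun ((sampleSource n).map (fun p => p.1 + p.2 • v)) t
      = charFun (stdVec n) t * charFun stdNormal (inner ℝ v t) := by
    rw [charFun_apply, charFun_apply, charFun_apply, integral_map (by fun_prop) (by fun_prop),
      ← integral_prod_mul]
    refine integral_congr_ae (ae_of_all _ fun p => ?_)
    simp only [inner_add_left, real_inner_smul_left]
    rw [← Complex.exp_add]
    congr 1
    simp
    ring
  rw [h1, charFun_multivariateGaussian hS, charFun_stdGaussian, charFun_gaussianReal,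
    ← Complex.exp_add]
  congr 1
  have h2 : inner ℝ v t = √β * (x ⬝ᵥ t) := by
    simp [hv, PiLp.inner_apply, dotProduct, Finset.mul_sum, mul_assoc, mul_comm, mul_left_comm]
  have h3 : (t : Fin n → ℝ) ⬝ᵥ (1 + β • Matrix.vecMulVec x x).mulVec t
      = ‖t‖ ^ 2 + (inner ℝ v t) ^ 2 := by
    rw [h2, mul_pow, Real.sq_sqrt hβ, EuclideanSpace.real_norm_sq_eq, Matrix.add_mulVec,
      dotProduct_add, Matrix.one_mulVec, Matrix.smul_mulVec, dotProduct_smul,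
      Matrix.vecMulVec_mulVec, dotProduct_smul]
    simp [dotProduct, sq, mul_comm]
  rw [h3]
  push_cast
  simp
  ring

/-! ### The null and planted distributions -/

section Wishart

variable {n N : ℕ}

lemma wishartNull_eq : wishartNull n N = Measure.pi fun _ => stdVec n := by
  simp [wishartNull]

instance : IsProbabilityMeasure (wishartNull n N) := by
  rw [wishartNull_eq]; infer_instance

/-- The observation with spike `x` as a function of the noise and the latent variables. -/
def spikeMap (n N : ℕ) (β : ℝ) (x : Fin n → ℝ) (q : Fin N → EuclideanSpace ℝ (Fin n) × ℝ) :
    WishartData n N :=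
  fun k => (q k).1 + (q k).2 • WithLp.toLp 2 (√β • x)

lemma spikeMap_apply (β : ℝ) (x : Fin n → ℝ) (q : Fin N → EuclideanSpace ℝ (Fin n) × ℝ)
    (k : Fin N) (i : Fin n) :
    spikeMap n N β x q k i = (q k).1 i + √β * (q k).2 * x i := by
  simp [spikeMap]
  ring

lemma measurable_spikeMap (β : ℝ) :
    Measurable fun p : (Fin n → ℝ) × (Fin N → EuclideanSpace ℝ (Fin n) × ℝ) =>
      spikeMap n N β p.1 p.2 := by
  unfold spikeMap
  fun_prop

lemma measurable_spikeMap_right (β : ℝ) (x : Fin n → ℝ) : Measurable (spikeMap n N β x) :=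
  (measurable_spikeMap β).comp (measurable_prodMk_left (x := x))

lemma wishartSpike_eq_map {β : ℝ} (hβ : 0 ≤ β) (x : Fin n → ℝ) :
    wishartSpike n N β x
      = (Measure.pi fun _ : Fin N => sampleSource n).map (spikeMap n N β x) := by
  have : IsProbabilityMeasure
      ((sampleSource n).map (fun p => p.1 + p.2 • WithLp.toLp 2 (√β • x))) :=
    Measure.isProbabilityMeasure_map (by fun_prop)
  simp only [wishartSpike, multivariateGaussian_spike hβ]
  exact (Measure.pi_map_pi (f := fun (_ : Fin N) (p : EuclideanSpace ℝ (Fin n) × ℝ) =>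
    p.1 + p.2 • WithLp.toLp 2 (√β • x)) fun _ => by fun_prop).symm

/-- Needed to evaluate `Measure.bind`. The mass of a set is the mass of a section of its preimage
under the jointly measurable `spikeMap`. -/
lemma measurable_wishartSpike {β : ℝ} (hβ : 0 ≤ β) : Measurable (wishartSpike n N β) := by
  refine Measure.measurable_of_measurable_coe _ fun s hs => ?_
  have e : ∀ x, wishartSpike n N β x s = (Measure.pi fun _ : Fin N => sampleSource n)
      (Prod.mk x ⁻¹' ((fun p : (Fin n → ℝ) × (Fin N → EuclideanSpace ℝ (Fin n) × ℝ) =>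
        spikeMap n N β p.1 p.2) ⁻¹' s)) := fun x => by
    rw [wishartSpike_eq_map hβ, Measure.map_apply (measurable_spikeMap_right β x) hs]
    rfl
  simp_rw [e]
  exact measurable_measure_prodMk_left (measurable_spikeMap β hs)

lemma wishartPlanted_eq_map {β : ℝ} (hβ : 0 ≤ β) (X : Measure (Fin n → ℝ)) [SFinite X] :
    wishartPlanted n N β X = (X.prod (Measure.pi fun _ : Fin N => sampleSource n)).map
      fun p => spikeMap n N β p.1 p.2 := by
  ext s hs
  rw [wishartPlanted, Measure.bind_apply hs (measurable_wishartSpike hβ).aemeasurable,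
    Measure.map_apply (measurable_spikeMap β) hs, Measure.prod_apply (measurable_spikeMap β hs)]
  refine lintegral_congr fun x => ?_
  rw [wishartSpike_eq_map hβ, Measure.map_apply (measurable_spikeMap_right β x) hs]
  rfl

/-- Given its latent variable, a sample is a shifted standard Gaussian vector, so null sets stay
null by Fubini and no density has to be computed. -/
lemma wishartSpike_absolutelyContinuous {β : ℝ} (hβ : 0 ≤ β) (x : Fin n → ℝ) :
    wishartSpike n N β x ≪ wishartNull n N := by
  simp only [wishartSpike, wishartNull_eq]
  refine absolutelyContinuous_pi_fin fun _ => ?_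
  rw [multivariateGaussian_spike hβ]
  refine Measure.AbsolutelyContinuous.mk fun s hs h0 => ?_
  have hm : Measurable fun p : EuclideanSpace ℝ (Fin n) × ℝ =>
    p.1 + p.2 • WithLp.toLp 2 (√β • x) := by fun_prop
  rw [Measure.map_apply hm hs, Measure.prod_apply_symm (hm hs)]
  refine (lintegral_congr fun g => ?_).trans lintegral_zero
  have := map_add_stdVec_absolutelyContinuous (g • WithLp.toLp 2 (√β • x)) h0
  rwa [Measure.map_apply (by fun_prop) hs] at this

lemma wishartPlanted_absolutelyContinuous {β : ℝ} (hβ : 0 ≤ β) (X : Measure (Fin n → ℝ)) :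
    wishartPlanted n N β X ≪ wishartNull n N := by
  refine Measure.AbsolutelyContinuous.mk fun s hs h0 => ?_
  rw [wishartPlanted, Measure.bind_apply hs (measurable_wishartSpike hβ).aemeasurable]
  exact (lintegral_congr fun x => wishartSpike_absolutelyContinuous hβ x h0).trans lintegral_zero

lemma isProbabilityMeasure_wishartPlanted {β : ℝ} (hβ : 0 ≤ β) (X : Measure (Fin n → ℝ))
    [IsProbabilityMeasure X] : IsProbabilityMeasure (wishartPlanted n N β X) := by
  rw [wishartPlanted_eq_map hβ]
  exact Measure.isProbabilityMeasure_map (measurable_spikeMap β).aemeasurable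

/-! ### Moments of the entries -/

lemma measurable_entry (k : Fin N) (i : Fin n) :
    Measurable fun y : WishartData n N => y k i := by
  fun_prop

lemma hasAllMoments_wishartNull (k : Fin N) (i : Fin n) :
    HasAllMoments (fun y : WishartData n N => y k i) (wishartNull n N) := by
  rw [wishartNull_eq]
  exact ((hasAllMoments_gaussianReal 0 1).comp (measurePreserving_eval_stdVec i)).comp
    (measurePreserving_eval (fun _ : Fin N => stdVec n) k)

lemma hasAllMoments_sampleSource_fst (i : Fin n) :
    HasAllMoments (fun p : EuclideanSpace ℝ (Fin n) × ℝ => p.1 i) (sampleSource n) :=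
  ((hasAllMoments_gaussianReal 0 1).comp (measurePreserving_eval_stdVec i)).comp
    measurePreserving_fst

lemma hasAllMoments_sampleSource_snd :
    HasAllMoments (fun p : EuclideanSpace ℝ (Fin n) × ℝ => p.2) (sampleSource n) :=
  (hasAllMoments_gaussianReal 0 1).comp measurePreserving_snd

lemma hasAllMoments_spikeMap (β : ℝ) {X : Measure (Fin n → ℝ)} [IsProbabilityMeasure X]
    (hX : ∀ i, HasAllMoments (fun x => x i) X) (k : Fin N) (i : Fin n) :
    HasAllMoments (fun p : (Fin n → ℝ) × (Fin N → EuclideanSpace ℝ (Fin n) × ℝ) =>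
      spikeMap n N β p.1 p.2 k i) (X.prod (Measure.pi fun _ : Fin N => sampleSource n)) := by
  have hk : MeasurePreserving
      (fun p : (Fin n → ℝ) × (Fin N → EuclideanSpace ℝ (Fin n) × ℝ) => p.2 k)
      (X.prod (Measure.pi fun _ : Fin N => sampleSource n)) (sampleSource n) :=
    (measurePreserving_eval (fun _ : Fin N => sampleSource n) k).comp measurePreserving_snd
  simp only [spikeMap_apply]
  exact ((hasAllMoments_sampleSource_fst i).comp hk).add
    (((HasAllMoments.const _).mul (hasAllMoments_sampleSource_snd.comp hk)).mul
      ((hX i).comp measurePreserving_fst))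

lemma hasAllMoments_wishartPlanted {β : ℝ} (hβ : 0 ≤ β) {X : Measure (Fin n → ℝ)}
    [IsProbabilityMeasure X] (hX : ∀ i, HasAllMoments (fun x => x i) X) (k : Fin N) (i : Fin n) :
    HasAllMoments (fun y : WishartData n N => y k i) (wishartPlanted n N β X) := fun p => by
  rw [wishartPlanted_eq_map hβ, memLp_map_measure_iff
    (measurable_entry k i).aestronglyMeasurable
    (measurable_spikeMap β).aemeasurable]
  exact hasAllMoments_spikeMap β hX k i p

/-! ### Multivariate Hermite polynomials -/

/-- The product of Hermite polynomials in the entries of the data with the degrees `α`. -/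
def hermiteProd (α : Fin N × Fin n → ℕ) (y : WishartData n N) : ℝ :=
  ∏ k, ∏ i, (hermiteReal (α (k, i))).eval (y k i)

lemma hermiteProd_mem_polysOfDegreeLE {D : ℕ} {α : Fin N × Fin n → ℕ} (hα : ∑ κ, α κ ≤ D) :
    hermiteProd α ∈ polysOfDegreeLE n N D := by
  refine ⟨∏ κ, Polynomial.aeval (MvPolynomial.X κ) (hermiteReal (α κ)), ?_, fun y => ?_⟩
  · refine (MvPolynomial.totalDegree_finsetProd _ _).trans
      ((Finset.sum_le_sum fun κ _ => ?_).trans hα)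
    rw [Polynomial.aeval_eq_sum_range]
    refine MvPolynomial.totalDegree_finsetSum_le fun j hj => ?_
    refine (MvPolynomial.totalDegree_smul_le _ _).trans ?_
    rw [MvPolynomial.totalDegree_X_pow]
    have := Finset.mem_range.1 hj
    rw [natDegree_hermiteReal] at this
    omega
  · rw [map_prod, hermiteProd, Fintype.prod_prod_type]
    refine Finset.prod_congr rfl fun k _ => Finset.prod_congr rfl fun i _ => ?_
    rw [Polynomial.aeval_def, Polynomial.hom_eval₂, Polynomial.eval]
    congr 1
    · ext; simp
    · simp

lemma hasAllMoments_of_mem_polysOfDegreeLE {D : ℕ} {P : Measure (WishartData n N)}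
    [IsFiniteMeasure P] (hP : ∀ k i, HasAllMoments (fun y : WishartData n N => y k i) P)
    {f : WishartData n N → ℝ} (hf : f ∈ polysOfDegreeLE n N D) : HasAllMoments f P := by
  obtain ⟨p, -, hp⟩ := hf
  rw [show f = fun y => MvPolynomial.eval (fun ij => y ij.1 ij.2) p from funext hp]
  exact HasAllMoments.mvEval (f := fun (ij : Fin N × Fin n) (y : WishartData n N) =>
    y ij.1 ij.2) (fun ij => hP ij.1 ij.2) p

lemma hasAllMoments_hermiteProd {P : Measure (WishartData n N)}
    [IsFiniteMeasure P] (hP : ∀ k i, HasAllMoments (fun y : WishartData n N => y k i) P)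
    (α : Fin N × Fin n → ℕ) : HasAllMoments (hermiteProd α) P :=
  hasAllMoments_of_mem_polysOfDegreeLE hP (hermiteProd_mem_polysOfDegreeLE le_rfl)

lemma integral_hermiteProd_mul (α α' : Fin N × Fin n → ℕ) :
    ∫ y, hermiteProd α y * hermiteProd α' y ∂(wishartNull n N)
      = if α = α' then ∏ κ, ((α κ).factorial : ℝ) else 0 := by
  simp only [hermiteProd, ← Finset.prod_mul_distrib]
  rw [wishartNull_eq, integral_fintype_prod_eq_prod (f := fun (k : Fin N)
    (z : EuclideanSpace ℝ (Fin n)) => ∏ i, ((hermiteReal (α (k, i))).eval (z i)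
      * (hermiteReal (α' (k, i))).eval (z i)))]
  have hk : ∀ k, ∫ z : EuclideanSpace ℝ (Fin n), ∏ i, ((hermiteReal (α (k, i))).eval (z i)
      * (hermiteReal (α' (k, i))).eval (z i)) ∂(stdVec n)
      = ∏ i, if α (k, i) = α' (k, i) then ((α (k, i)).factorial : ℝ) else 0 := fun k => by
    rw [integral_prod_stdVec fun i u => (hermiteReal (α (k, i))).eval u
      * (hermiteReal (α' (k, i))).eval u]
    simp only [integral_hermiteReal_mul]
  simp only [hk]
  rw [← Fintype.prod_prod_type (f := fun κ : Fin N × Fin n =>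
    if α κ = α' κ then ((α κ).factorial : ℝ) else 0)]
  split_ifs with h
  · subst h
    simp
  · obtain ⟨κ, hκ⟩ := Function.ne_iff.1 h
    exact Finset.prod_eq_zero (Finset.mem_univ κ) (if_neg hκ)

/-- The moment of order `α` of the signal `√β g xᵀ`. -/
def signalMoment (N : ℕ) (β : ℝ) (X : Measure (Fin n → ℝ)) (α : Fin N × Fin n → ℕ) : ℝ :=
  ∫ p, ∏ k, ∏ i, (√β * p.2 k * p.1 i) ^ α (k, i)
    ∂(X.prod (Measure.pi fun _ : Fin N => stdNormal))

lemma hasAllMoments_signal (β : ℝ) {X : Measure (Fin n → ℝ)} [IsProbabilityMeasure X]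
    (hX : ∀ i, HasAllMoments (fun x => x i) X) (k : Fin N) (i : Fin n) :
    HasAllMoments (fun p : (Fin n → ℝ) × (Fin N → ℝ) => √β * p.2 k * p.1 i)
      (X.prod (Measure.pi fun _ : Fin N => stdNormal)) := by
  have hk : MeasurePreserving (fun p : (Fin n → ℝ) × (Fin N → ℝ) => p.2 k)
      (X.prod (Measure.pi fun _ : Fin N => stdNormal)) stdNormal :=
    (measurePreserving_eval (fun _ : Fin N => stdNormal) k).comp measurePreserving_snd
  exact ((HasAllMoments.const _).mul ((hasAllMoments_gaussianReal 0 1).comp hk)).mul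
    ((hX i).comp measurePreserving_fst)

/-- With the latent variable fixed, the coordinates are independent shifted Gaussians, and each
Hermite factor averages to a power of its shift. -/
lemma integral_hermiteProd_sampleSource (a : Fin n → ℕ) (w : Fin n → ℝ) :
    ∫ p, ∏ i, (hermiteReal (a i)).eval (p.1 i + p.2 * w i) ∂(sampleSource n)
      = ∫ g, ∏ i, (g * w i) ^ a i ∂stdNormal := by
  rw [integral_prod_symm]
  · refine integral_congr_ae (ae_of_all _ fun g => ?_)
    simp only [integral_prod_stdVec (fun i u => (hermiteReal (a i)).eval (u + g * w i)),
      integral_hermiteReal_add]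
  · exact (HasAllMoments.prod _ fun i _ => ((hasAllMoments_sampleSource_fst i).add
      (hasAllMoments_sampleSource_snd.mul (HasAllMoments.const (w i)))).eval _).integrable

lemma integral_hermiteProd_wishartPlanted {β : ℝ} (hβ : 0 ≤ β) {X : Measure (Fin n → ℝ)}
    [IsProbabilityMeasure X] (hX : ∀ i, HasAllMoments (fun x => x i) X)
    (α : Fin N × Fin n → ℕ) :
    ∫ y, hermiteProd α y ∂(wishartPlanted n N β X) = signalMoment N β X α := by
  have hm : Measurable (hermiteProd α) := by
    unfold hermiteProd
    refine Finset.measurable_prod _ fun k _ => Finset.measurable_prod _ fun i _ => ?_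
    exact (hermiteReal (α (k, i))).continuous.measurable.comp (by fun_prop)
  rw [wishartPlanted_eq_map hβ, integral_map (measurable_spikeMap β).aemeasurable
    hm.aestronglyMeasurable, integral_prod, signalMoment, integral_prod]
  · refine integral_congr_ae (ae_of_all _ fun x => ?_)
    simp only [hermiteProd, spikeMap_apply]
    rw [integral_fintype_prod_eq_prod (f := fun (k : Fin N)
        (q : EuclideanSpace ℝ (Fin n) × ℝ) =>
          ∏ i, (hermiteReal (α (k, i))).eval (q.1 i + √β * q.2 * x i)),
      integral_fintype_prod_eq_prod (f := fun (k : Fin N) (g : ℝ) =>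
          ∏ i, (√β * g * x i) ^ α (k, i))]
    refine Finset.prod_congr rfl fun k _ => ?_
    have := integral_hermiteProd_sampleSource (fun i => α (k, i)) (fun i => √β * x i)
    simp_rw [show ∀ (g : ℝ) (i : Fin n), √β * g * x i = g * (√β * x i) from
      fun g i => by ring]
    exact this
  · exact (HasAllMoments.prod _ fun k _ => HasAllMoments.prod _ fun i _ =>
      (hasAllMoments_signal β hX k i).pow _).integrable
  · exact (HasAllMoments.prod _ fun k _ => HasAllMoments.prod _ fun i _ =>
      (hasAllMoments_spikeMap β hX k i).eval _).integrable

end Wishart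

section Projection

variable {n N D : ℕ}

/-! ### Hermite expansion of polynomials -/

/-- The multi-indices of total degree at most `D`. -/
def multiIndices (κ : Type*) [Fintype κ] [DecidableEq κ] (D : ℕ) : Finset (κ → ℕ) :=
  (Finset.range (D + 1)).biUnion fun d => Finset.piAntidiag Finset.univ d

lemma mem_multiIndices {κ : Type*} [Fintype κ] [DecidableEq κ] {α : κ → ℕ} :
    α ∈ multiIndices κ D ↔ ∑ i, α i ≤ D := by
  simp [multiIndices]

lemma sum_multiIndices {κ : Type*} [Fintype κ] [DecidableEq κ] (f : (κ → ℕ) → ℝ) :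
    ∑ α ∈ multiIndices κ D, f α
      = ∑ d ∈ Finset.range (D + 1), ∑ α ∈ Finset.piAntidiag Finset.univ d, f α := by
  refine Finset.sum_biUnion fun d _ d' _ hd => ?_
  rw [Function.onFun, Finset.disjoint_left]
  intro α h h'
  simp only [Finset.mem_piAntidiag] at h h'
  exact hd (h.1.symm.trans h'.1)

lemma sum_mul_mem_polysOfDegreeLE {ι : Type*} (s : Finset ι) (c : ι → ℝ)
    {f : ι → WishartData n N → ℝ} (hf : ∀ α ∈ s, f α ∈ polysOfDegreeLE n N D) :
    (fun y => ∑ α ∈ s, c α * f α y) ∈ polysOfDegreeLE n N D := by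
  choose! p hp hfp using hf
  refine ⟨∑ α ∈ s, c α • p α, ?_, fun y => ?_⟩
  · exact MvPolynomial.totalDegree_finsetSum_le fun α hα =>
      (MvPolynomial.totalDegree_smul_le _ _).trans (hp α hα)
  · rw [map_sum]
    refine Finset.sum_congr rfl fun α hα => ?_
    rw [hfp α hα, MvPolynomial.smul_eval]

/-- Multiply out the one-variable expansions. The indices stay in the box below `m`, so the total
degree does not grow. -/
lemma exists_monomial_eq_sum_hermiteProd (m : Fin N × Fin n → ℕ) :
    ∃ c : (Fin N × Fin n → ℕ) → ℝ, ∀ y : WishartData n N,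
      ∏ κ : Fin N × Fin n, y κ.1 κ.2 ^ m κ
        = ∑ b ∈ Fintype.piFinset fun κ => Finset.range (m κ + 1), c b * hermiteProd b y := by
  have h : ∀ κ, ∃ c : ℕ → ℝ, (Polynomial.X : Polynomial ℝ) ^ m κ
      = ∑ b ∈ Finset.range (m κ + 1), Polynomial.C (c b) * hermiteReal b := fun κ =>
    exists_eq_sum_hermiteReal (m κ) _ (by simp)
  choose c hc using h
  refine ⟨fun b => ∏ κ, c κ (b κ), fun y => ?_⟩
  have h2 : ∀ κ : Fin N × Fin n, y κ.1 κ.2 ^ m κ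
      = ∑ b ∈ Finset.range (m κ + 1), c κ b * (hermiteReal b).eval (y κ.1 κ.2) := fun κ => by
    have := congrArg (Polynomial.eval (y κ.1 κ.2)) (hc κ)
    simpa [Polynomial.eval_finsetSum] using this
  simp_rw [h2]
  rw [Finset.prod_univ_sum]
  refine Finset.sum_congr rfl fun b _ => ?_
  rw [Finset.prod_mul_distrib, hermiteProd, ← Fintype.prod_prod_type
    (f := fun κ : Fin N × Fin n => (hermiteReal (b κ)).eval (y κ.1 κ.2))]

lemma exists_eq_sum_hermiteProd {f : WishartData n N → ℝ} (hf : f ∈ polysOfDegreeLE n N D) :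
    ∃ c : (Fin N × Fin n → ℕ) → ℝ,
      f = fun y => ∑ α ∈ multiIndices (Fin N × Fin n) D, c α * hermiteProd α y := by
  set S := Submodule.span ℝ
    (hermiteProd (n := n) (N := N) '' (multiIndices (Fin N × Fin n) D : Set _)) with hS
  have key : f ∈ S := by
    obtain ⟨p, hp, hfp⟩ := hf
    have e : f = ∑ m ∈ p.support, p.coeff m •
        fun y : WishartData n N => ∏ κ : Fin N × Fin n, y κ.1 κ.2 ^ m κ := by
      ext y
      rw [hfp, MvPolynomial.eval_eq']
      simp
    rw [e]
    refine S.sum_mem fun m hm => S.smul_mem _ ?_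
    have hmD : ∑ κ, m κ ≤ D := by
      refine le_trans (le_of_eq ?_) ((MvPolynomial.le_totalDegree hm).trans hp)
      rw [Finsupp.sum_fintype _ _ (fun _ => rfl)]
    obtain ⟨c, hc⟩ := exists_monomial_eq_sum_hermiteProd (n := n) (N := N) m
    have e2 : (fun y : WishartData n N => ∏ κ : Fin N × Fin n, y κ.1 κ.2 ^ m κ)
        = ∑ b ∈ Fintype.piFinset fun κ => Finset.range (m κ + 1), c b • hermiteProd b := by
      ext y
      rw [hc]
      simp
    rw [e2]
    refine S.sum_mem fun b hb => S.smul_mem _ (Submodule.subset_span ⟨b, ?_, rfl⟩)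
    rw [Finset.mem_coe, mem_multiIndices]
    refine (Finset.sum_le_sum fun κ _ => ?_).trans hmD
    have := Fintype.mem_piFinset.1 hb κ
    rw [Finset.mem_range] at this
    omega
  obtain ⟨c, hc⟩ := (Submodule.mem_span_image_finset_iff_exists_fun' ℝ).1 key
  refine ⟨c, ?_⟩
  rw [← hc]
  ext y
  simp

/-! ### The projection of the likelihood ratio -/

variable {β : ℝ} {X : Measure (Fin n → ℝ)}

/-- The projection of the likelihood ratio onto the polynomials of degree at most `D`, expanded in
Hermite polynomials. -/
def hermiteProjection (N : ℕ) (β : ℝ) (X : Measure (Fin n → ℝ)) (D : ℕ) (y : WishartData n N) : ℝ :=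
  ∑ α ∈ multiIndices (Fin N × Fin n) D,
    signalMoment N β X α / (∏ κ, ((α κ).factorial : ℝ)) * hermiteProd α y

lemma hermiteProjection_mem : hermiteProjection N β X D ∈ polysOfDegreeLE n N D :=
  sum_mul_mem_polysOfDegreeLE _ _ fun _ hα =>
    hermiteProd_mem_polysOfDegreeLE (mem_multiIndices.1 hα)

lemma integral_hermiteProjection_mul_hermiteProd {α : Fin N × Fin n → ℕ}
    (hα : α ∈ multiIndices (Fin N × Fin n) D) :
    ∫ y, hermiteProjection N β X D y * hermiteProd α y ∂(wishartNull n N)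
      = signalMoment N β X α := by
  simp only [hermiteProjection, Finset.sum_mul, mul_assoc]
  rw [integral_finsetSum]
  · simp_rw [integral_const_mul, integral_hermiteProd_mul, mul_ite, mul_zero]
    rw [Finset.sum_ite_eq' _ _ _, if_pos hα]
    exact div_mul_cancel₀ _ (Finset.prod_ne_zero_iff.2 fun κ _ => by positivity)
  · intro α' _
    exact (((hasAllMoments_hermiteProd hasAllMoments_wishartNull α').mul
      (hasAllMoments_hermiteProd hasAllMoments_wishartNull α)).integrable).const_mul _

/-- Against polynomials of degree at most `D`, the projection represents the planted expectation; by
linearity it is enough to test Hermite products. -/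
lemma integral_hermiteProjection_mul (hβ : 0 ≤ β) [IsProbabilityMeasure X]
    (hX : ∀ i, HasAllMoments (fun x => x i) X) {h : WishartData n N → ℝ}
    (hh : h ∈ polysOfDegreeLE n N D) :
    ∫ y, hermiteProjection N β X D y * h y ∂(wishartNull n N)
      = ∫ y, h y ∂(wishartPlanted n N β X) := by
  have := isProbabilityMeasure_wishartPlanted (N := N) hβ X
  obtain ⟨c, rfl⟩ := exists_eq_sum_hermiteProd hh
  simp only [Finset.mul_sum, mul_left_comm _ (c _) _]
  rw [integral_finsetSum, integral_finsetSum]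
  · refine Finset.sum_congr rfl fun α hα => ?_
    rw [integral_const_mul, integral_const_mul, integral_hermiteProjection_mul_hermiteProd hα,
      integral_hermiteProd_wishartPlanted hβ hX]
  · exact fun α _ => (hasAllMoments_hermiteProd
      (hasAllMoments_wishartPlanted hβ hX) α).integrable.const_mul _
  · exact fun α _ => ((hasAllMoments_of_mem_polysOfDegreeLE hasAllMoments_wishartNull
      hermiteProjection_mem).mul (hasAllMoments_hermiteProd
        hasAllMoments_wishartNull α)).integrable.const_mul _

lemma integral_hermiteProjection_sq :
    ∫ y, hermiteProjection N β X D y ^ 2 ∂(wishartNull n N)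
      = ∑ α ∈ multiIndices (Fin N × Fin n) D,
          signalMoment N β X α ^ 2 / ∏ κ, ((α κ).factorial : ℝ) := by
  have e : ∀ y, hermiteProjection N β X D y ^ 2
      = ∑ α ∈ multiIndices (Fin N × Fin n) D,
        signalMoment N β X α / (∏ κ, ((α κ).factorial : ℝ)) *
          (hermiteProjection N β X D y * hermiteProd α y) := fun y => by
    conv_lhs => rw [sq, hermiteProjection, Finset.sum_mul]
    refine Finset.sum_congr rfl fun α _ => ?_
    rw [hermiteProjection]
    ring
  simp_rw [e]
  rw [integral_finsetSum]
  · refine Finset.sum_congr rfl fun α hα => ?_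
    rw [integral_const_mul, integral_hermiteProjection_mul_hermiteProd hα]
    ring
  · exact fun α _ => ((hasAllMoments_of_mem_polysOfDegreeLE hasAllMoments_wishartNull
      hermiteProjection_mem).mul (hasAllMoments_hermiteProd
        hasAllMoments_wishartNull α)).integrable.const_mul _

lemma integrable_likelihoodRatio_mul (hβ : 0 ≤ β) [IsProbabilityMeasure X]
    (hX : ∀ i, HasAllMoments (fun x => x i) X) {h : WishartData n N → ℝ}
    (hh : h ∈ polysOfDegreeLE n N D) :
    Integrable (fun y => likelihoodRatio n N β X y * h y) (wishartNull n N) := by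
  have := isProbabilityMeasure_wishartPlanted (N := N) hβ X
  exact (integrable_toReal_rnDeriv_mul_iff (wishartPlanted_absolutelyContinuous hβ X)).2
    (hasAllMoments_of_mem_polysOfDegreeLE (hasAllMoments_wishartPlanted hβ hX) hh).integrable

lemma integral_likelihoodRatio_mul (hβ : 0 ≤ β) [IsProbabilityMeasure X]
    (h : WishartData n N → ℝ) :
    ∫ y, likelihoodRatio n N β X y * h y ∂(wishartNull n N)
      = ∫ y, h y ∂(wishartPlanted n N β X) := by
  have := isProbabilityMeasure_wishartPlanted (N := N) hβ X
  exact integral_toReal_rnDeriv_mul (wishartPlanted_absolutelyContinuous hβ X)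

lemma isOrthogonalProjection_hermiteProjection (hβ : 0 ≤ β) [IsProbabilityMeasure X]
    (hX : ∀ i, HasAllMoments (fun x => x i) X) :
    IsOrthogonalProjection (wishartNull n N) (polysOfDegreeLE n N D)
      (likelihoodRatio n N β X) (hermiteProjection N β X D) := by
  have hm : HasAllMoments (hermiteProjection N β X D) (wishartNull n N) :=
    hasAllMoments_of_mem_polysOfDegreeLE hasAllMoments_wishartNull hermiteProjection_mem
  refine ⟨hermiteProjection_mem, by exact_mod_cast hm 2, fun h hh => ?_⟩
  have i1 := integrable_likelihoodRatio_mul (N := N) hβ hX hh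
  have i2 := (hm.mul (hasAllMoments_of_mem_polysOfDegreeLE
    hasAllMoments_wishartNull hh)).integrable
  simp_rw [sub_mul]
  exact ⟨i1.sub i2, by rw [integral_sub i1 i2, integral_likelihoodRatio_mul hβ,
    integral_hermiteProjection_mul hβ hX hh, sub_self]⟩

lemma isOrthogonalProjection_lowDegreeLR (hβ : 0 ≤ β) [IsProbabilityMeasure X]
    (hX : ∀ i, HasAllMoments (fun x => x i) X) :
    IsOrthogonalProjection (wishartNull n N) (polysOfDegreeLE n N D)
      (likelihoodRatio n N β X) (lowDegreeLR n N β X D) := by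
  have h : ∃ g, IsOrthogonalProjection (wishartNull n N) (polysOfDegreeLE n N D)
      (likelihoodRatio n N β X) g := ⟨_, isOrthogonalProjection_hermiteProjection hβ hX⟩
  rw [lowDegreeLR, orthogonalProjection, dif_pos h]
  exact h.choose_spec

lemma integral_mul_of_isOrthogonalProjection (hβ : 0 ≤ β) [IsProbabilityMeasure X]
    (hX : ∀ i, HasAllMoments (fun x => x i) X) {g h : WishartData n N → ℝ}
    (hg : IsOrthogonalProjection (wishartNull n N) (polysOfDegreeLE n N D)
      (likelihoodRatio n N β X) g) (hh : h ∈ polysOfDegreeLE n N D) :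
    ∫ y, g y * h y ∂(wishartNull n N) = ∫ y, h y ∂(wishartPlanted n N β X) := by
  have i1 := integrable_likelihoodRatio_mul (N := N) hβ hX hh
  have i2 := ((hasAllMoments_of_mem_polysOfDegreeLE hasAllMoments_wishartNull hg.1).mul
    (hasAllMoments_of_mem_polysOfDegreeLE hasAllMoments_wishartNull hh)).integrable
  have := (hg.2.2 h hh).2
  simp_rw [sub_mul] at this
  rw [integral_sub i1 i2, integral_likelihoodRatio_mul hβ] at this
  linarith

/-! ### The norm of the projection -/

/-- The moments of the overlap `⟨x, x'⟩` of two independent draws from `μ`. -/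
def overlapMoment {m : ℕ} (μ : Measure (Fin m → ℝ)) (d : ℕ) : ℝ :=
  ∫ p, (∑ i, p.1 i * p.2 i) ^ d ∂(μ.prod μ)

/-- `lowDegreeLR` is obtained by choice, so it is compared with `p = hermiteProjection` only through
the functional that both represent: for any projection `g`, `⟨g, g⟩ = E_P g = ⟨p, g⟩ = E_P p = ⟨p,
p⟩`. -/
lemma integral_lowDegreeLR_sq (hβ : 0 ≤ β) [IsProbabilityMeasure X]
    (hX : ∀ i, HasAllMoments (fun x => x i) X) :
    ∫ y, lowDegreeLR n N β X D y ^ 2 ∂(wishartNull n N)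
      = ∑ α ∈ multiIndices (Fin N × Fin n) D,
          signalMoment N β X α ^ 2 / ∏ κ, ((α κ).factorial : ℝ) := by
  have hL := isOrthogonalProjection_lowDegreeLR (N := N) (D := D) hβ hX
  rw [← integral_hermiteProjection_sq]
  simp_rw [sq]
  rw [integral_mul_of_isOrthogonalProjection hβ hX hL hL.1,
    ← integral_hermiteProjection_mul hβ hX hL.1]
  simp_rw [mul_comm (hermiteProjection _ _ _ _ _) (lowDegreeLR _ _ _ _ _ _)]
  rw [integral_mul_of_isOrthogonalProjection hβ hX hL hermiteProjection_mem,
    ← integral_hermiteProjection_mul hβ hX hermiteProjection_mem]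

/-- The moment splits into a prior factor and a Gaussian factor; squaring each is integrating over
two independent copies. -/
lemma signalMoment_sq (hβ : 0 ≤ β) [IsProbabilityMeasure X] (α : Fin N × Fin n → ℕ) :
    signalMoment N β X α ^ 2 = β ^ (∑ κ, α κ) *
      ∫ p, ∏ κ, (p.1.1 κ.2 * p.1.2 κ.2 * (p.2.1 κ.1 * p.2.2 κ.1)) ^ α κ
        ∂((X.prod X).prod ((Measure.pi fun _ : Fin N => stdNormal).prod
          (Measure.pi fun _ : Fin N => stdNormal))) := by
  set G := Measure.pi fun _ : Fin N => stdNormal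
  have h1 : signalMoment N β X α = √β ^ (∑ κ, α κ) *
      ((∫ x, ∏ κ : Fin N × Fin n, x κ.2 ^ α κ ∂X)
        * ∫ g, ∏ κ : Fin N × Fin n, g κ.1 ^ α κ ∂G) := by
    rw [signalMoment, ← integral_prod_mul, ← integral_const_mul]
    refine integral_congr_ae (ae_of_all _ fun p => ?_)
    dsimp only
    rw [← Fintype.prod_prod_type (f := fun κ : Fin N × Fin n =>
      (√β * p.2 κ.1 * p.1 κ.2) ^ α κ), ← Finset.prod_pow_eq_pow_sum,
      ← Finset.prod_mul_distrib, ← Finset.prod_mul_distrib]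
    refine Finset.prod_congr rfl fun κ _ => ?_
    rw [← mul_pow, ← mul_pow]
    ring
  have h2 : ∀ (p : ((Fin n → ℝ) × (Fin n → ℝ)) × ((Fin N → ℝ) × (Fin N → ℝ))),
      ∏ κ : Fin N × Fin n, (p.1.1 κ.2 * p.1.2 κ.2 * (p.2.1 κ.1 * p.2.2 κ.1)) ^ α κ
      = ((∏ κ : Fin N × Fin n, p.1.1 κ.2 ^ α κ) * ∏ κ : Fin N × Fin n, p.1.2 κ.2 ^ α κ)
        * ((∏ κ : Fin N × Fin n, p.2.1 κ.1 ^ α κ) * ∏ κ : Fin N × Fin n, p.2.2 κ.1 ^ α κ) :=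
    fun p => by simp only [← Finset.prod_mul_distrib, mul_pow]
  simp_rw [h2]
  rw [integral_prod_mul (μ := X.prod X) (ν := G.prod G)
    (fun q : (Fin n → ℝ) × (Fin n → ℝ) =>
      (∏ κ : Fin N × Fin n, q.1 κ.2 ^ α κ) * ∏ κ : Fin N × Fin n, q.2 κ.2 ^ α κ)
    (fun q : (Fin N → ℝ) × (Fin N → ℝ) =>
      (∏ κ : Fin N × Fin n, q.1 κ.1 ^ α κ) * ∏ κ : Fin N × Fin n, q.2 κ.1 ^ α κ),
    integral_prod_mul (μ := X) (ν := X) (fun x => ∏ κ : Fin N × Fin n, x κ.2 ^ α κ)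
      (fun x => ∏ κ : Fin N × Fin n, x κ.2 ^ α κ),
    integral_prod_mul (μ := G) (ν := G) (fun x => ∏ κ : Fin N × Fin n, x κ.1 ^ α κ)
      (fun x => ∏ κ : Fin N × Fin n, x κ.1 ^ α κ), h1]
  have h3 : β ^ (∑ κ, α κ) = (√β ^ (∑ κ, α κ)) ^ 2 := by
    rw [← pow_mul, mul_comm, pow_mul, Real.sq_sqrt hβ]
  rw [h3]
  ring

lemma integral_lowDegreeLR_sq_eq_sum (hβ : 0 ≤ β) [IsProbabilityMeasure X]
    (hX : ∀ i, HasAllMoments (fun x => x i) X) :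
    ∫ y, lowDegreeLR n N β X D y ^ 2 ∂(wishartNull n N)
      = ∑ d ∈ Finset.range (D + 1), β ^ d / d.factorial * (overlapMoment X d
          * overlapMoment (Measure.pi fun _ : Fin N => stdNormal) d) := by
  rw [integral_lowDegreeLR_sq hβ hX, sum_multiIndices]
  refine Finset.sum_congr rfl fun d _ => ?_
  set G := Measure.pi fun _ : Fin N => stdNormal with hG
  have hmX : ∀ i, HasAllMoments (fun p : ((Fin n → ℝ) × (Fin n → ℝ)) ×
      ((Fin N → ℝ) × (Fin N → ℝ)) => p.1.1 i * p.1.2 i) ((X.prod X).prod (G.prod G)) := fun i =>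
    (((hX i).comp measurePreserving_fst).mul ((hX i).comp measurePreserving_snd)).comp
      measurePreserving_fst
  have hg : ∀ k, HasAllMoments (fun g : Fin N → ℝ => g k) G := fun k =>
    (hasAllMoments_gaussianReal 0 1).comp (measurePreserving_eval (fun _ : Fin N => stdNormal) k)
  have hmG : ∀ k, HasAllMoments (fun p : ((Fin n → ℝ) × (Fin n → ℝ)) ×
      ((Fin N → ℝ) × (Fin N → ℝ)) => p.2.1 k * p.2.2 k) ((X.prod X).prod (G.prod G)) := fun k =>
    (((hg k).comp measurePreserving_fst).mul ((hg k).comp measurePreserving_snd)).comp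
      measurePreserving_snd
  rw [overlapMoment, overlapMoment, ← integral_prod_mul, ← integral_const_mul]
  -- The product of the two overlaps is a single sum over the pairs `(k, i)`, to which the
  -- multinomial theorem applies; the multinomial coefficient turns `1 / d!` into `1 / ∏ α!`.
  have e : ∀ p : ((Fin n → ℝ) × (Fin n → ℝ)) × ((Fin N → ℝ) × (Fin N → ℝ)),
      β ^ d / d.factorial * ((∑ i, p.1.1 i * p.1.2 i) ^ d * (∑ k, p.2.1 k * p.2.2 k) ^ d)
      = ∑ α ∈ Finset.piAntidiag (Finset.univ : Finset (Fin N × Fin n)) d,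
        β ^ d / (∏ κ, ((α κ).factorial : ℝ)) *
        ∏ κ, (p.1.1 κ.2 * p.1.2 κ.2 * (p.2.1 κ.1 * p.2.2 κ.1)) ^ α κ := fun p => by
    rw [← mul_pow, Finset.sum_mul_sum, Finset.sum_comm, ← Fintype.sum_prod_type
      (f := fun κ : Fin N × Fin n => p.1.1 κ.2 * p.1.2 κ.2 * (p.2.1 κ.1 * p.2.2 κ.1)),
      Finset.sum_pow_eq_sum_piAntidiag, Finset.mul_sum]
    refine Finset.sum_congr rfl fun α hα => ?_
    rw [← mul_assoc]
    congr 1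
    have h1 := Nat.multinomial_spec Finset.univ α
    rw [(Finset.mem_piAntidiag.1 hα).1] at h1
    have h2 : (∏ κ, ((α κ).factorial : ℝ)) * (Nat.multinomial Finset.univ α : ℝ)
        = (d.factorial : ℝ) := by exact_mod_cast h1
    have h3 : (∏ κ, ((α κ).factorial : ℝ)) ≠ 0 :=
      Finset.prod_ne_zero_iff.2 fun κ _ => by positivity
    have h4 : (d.factorial : ℝ) ≠ 0 := by positivity
    field_simp
    linear_combination (β ^ d) * h2
  simp_rw [e]
  rw [integral_finsetSum]
  · refine Finset.sum_congr rfl fun α hα => ?_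
    rw [integral_const_mul, signalMoment_sq hβ, (Finset.mem_piAntidiag.1 hα).1]
    ring
  · exact fun α _ => (HasAllMoments.prod _ fun κ _ =>
      ((hmX κ.2).mul (hmG κ.1)).pow _).integrable.const_mul _

end Projection

/-! ### Moments of overlaps via exponential moments -/

/-- The inequality `u ≤ exp (u - 1)` at `u = t |s| / d`, raised to the power `d`. The constant is
the maximum of `s^d exp(-t s)` over `s ≥ 0`. -/
lemma abs_pow_le_mul_exp {d : ℕ} (hd : 0 < d) {t : ℝ} (ht : 0 < t) (s : ℝ) :
    |s| ^ d ≤ (d / (Real.exp 1 * t)) ^ d * (Real.exp (t * s) + Real.exp (-t * s)) := by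
  have hd' : (0 : ℝ) < d := by exact_mod_cast hd
  have h1 : |s| ≤ d / (Real.exp 1 * t) * Real.exp (t * |s| / d) := by
    have h := Real.add_one_le_exp (t * |s| / d - 1)
    rw [sub_add_cancel, Real.exp_sub, div_le_div_iff₀ hd' (Real.exp_pos 1)] at h
    rw [div_mul_eq_mul_div, le_div_iff₀ (by positivity)]
    linarith
  calc |s| ^ d ≤ (d / (Real.exp 1 * t) * Real.exp (t * |s| / d)) ^ d :=
        pow_le_pow_left₀ (abs_nonneg s) h1 d
    _ = (d / (Real.exp 1 * t)) ^ d * Real.exp (t * |s|) := by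
        rw [mul_pow, ← Real.exp_nat_mul]
        congr 2
        field_simp
    _ ≤ _ := by
        refine mul_le_mul_of_nonneg_left ?_ (by positivity)
        rcases abs_cases s with ⟨h, -⟩ | ⟨h, -⟩
        · rw [h]
          linarith [Real.exp_pos (-t * s)]
        · rw [h, mul_neg, ← neg_mul]
          linarith [Real.exp_pos (t * s)]

/-- A Chernoff-type bound for the moments of the overlap of two independent vectors with
independent entries. -/
lemma abs_overlapMoment_le {m d : ℕ} (hd : 0 < d) {t : ℝ} (ht : 0 < t) {μ : Measure ℝ}
    [IsProbabilityMeasure μ] (hμ : HasAllMoments (fun u => u) μ) {M : ℝ → ℝ}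
    (hexp : ∀ c, Integrable (fun u => Real.exp (c * u)) μ)
    (hM : ∀ c, ∫ u, Real.exp (c * u) ∂μ = M c) (heven : ∀ c, M (-c) = M c)
    (hint : Integrable (fun u => M (t * u)) μ) :
    |overlapMoment (Measure.pi fun _ : Fin m => μ) d|
      ≤ (d / (Real.exp 1 * t)) ^ d * 2 * (∫ u, M (t * u) ∂μ) ^ m := by
  set G := Measure.pi fun _ : Fin m => μ
  have hg : ∀ k, HasAllMoments (fun g : Fin m → ℝ => g k) G := fun k =>
    hμ.comp (measurePreserving_eval (fun _ : Fin m => μ) k)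
  have hmom : HasAllMoments (fun p : (Fin m → ℝ) × (Fin m → ℝ) =>
      (∑ i, p.1 i * p.2 i) ^ d) (G.prod G) :=
    (HasAllMoments.sum _ fun i _ => ((hg i).comp measurePreserving_fst).mul
      ((hg i).comp measurePreserving_snd)).pow d
  have hprod : ∀ (c : ℝ) (x x' : Fin m → ℝ),
      Real.exp (c * ∑ i, x i * x' i) = ∏ i, Real.exp (c * x i * x' i) := fun c x x' => by
    rw [← Real.exp_sum, Finset.mul_sum]
    simp only [mul_assoc]
  have hi : ∀ (c : ℝ) (x : Fin m → ℝ),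
      Integrable (fun x' : Fin m → ℝ => Real.exp (c * ∑ i, x i * x' i)) G := fun c x => by
    simp_rw [hprod]
    exact Integrable.fintype_prod (f := fun i u => Real.exp (c * x i * u)) fun i => hexp _
  have hv : ∀ (c : ℝ) (x : Fin m → ℝ),
      ∫ x', Real.exp (c * ∑ i, x i * x' i) ∂G = ∏ i, M (c * x i) := fun c x => by
    simp_rw [hprod]
    rw [integral_fintype_prod_eq_prod (f := fun i u => Real.exp (c * x i * u))]
    simp_rw [hM]
  -- With one vector fixed, the exponential moment factors over coordinates. Evenness of `M` merges
  -- the two signs, which is the source of the factor 2.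
  have hinner : ∀ x : Fin m → ℝ, ‖∫ x', (∑ i, x i * x' i) ^ d ∂G‖
      ≤ (d / (Real.exp 1 * t)) ^ d * 2 * ∏ i, M (t * x i) := fun x => by
    refine (norm_integral_le_of_norm_le (((hi t x).add (hi (-t) x)).const_mul
      ((d / (Real.exp 1 * t)) ^ d)) (ae_of_all _ fun x' => ?_)).trans (le_of_eq ?_)
    · rw [Real.norm_eq_abs, abs_pow]
      exact abs_pow_le_mul_exp hd ht _
    · rw [integral_const_mul, integral_add' (hi t x) (hi (-t) x), hv, hv]
      simp_rw [neg_mul, heven]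
      ring
  have hbound : Integrable (fun x : Fin m → ℝ => ∏ i, M (t * x i)) G :=
    Integrable.fintype_prod (f := fun _ u => M (t * u)) fun _ => hint
  rw [overlapMoment, integral_prod _ hmom.integrable, ← Real.norm_eq_abs]
  refine (norm_integral_le_of_norm_le (hbound.const_mul _) (ae_of_all _ hinner)).trans
    (le_of_eq ?_)
  rw [integral_const_mul, integral_fintype_prod_eq_prod (f := fun (_ : Fin m) u => M (t * u))]
  simp

lemma overlapMoment_zero {m : ℕ} (μ : Measure (Fin m → ℝ)) [IsProbabilityMeasure μ] :
    overlapMoment μ 0 = 1 := by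
  simp [overlapMoment]

/-! ### The overlap of Gaussian vectors -/

lemma gaussianPDFReal_mul_exp_sq (s u : ℝ) :
    gaussianPDFReal 0 1 u * Real.exp ((s * u) ^ 2 / 2)
      = (√(2 * Real.pi))⁻¹ * Real.exp (-((1 - s ^ 2) / 2) * u ^ 2) := by
  rw [gaussianPDFReal, mul_assoc, ← Real.exp_add]
  simp only [NNReal.coe_one, mul_one, sub_zero]
  congr 2
  ring

lemma integrable_exp_sq_stdNormal {s : ℝ} (hs : s ^ 2 < 1) :
    Integrable (fun u => Real.exp ((s * u) ^ 2 / 2)) stdNormal := by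
  rw [stdNormal, gaussianReal_of_var_ne_zero _ one_ne_zero,
    integrable_withDensity_iff_integrable_smul' (measurable_gaussianPDF 0 1)
      (ae_of_all _ fun _ => gaussianPDF_lt_top)]
  simp only [toReal_gaussianPDF, smul_eq_mul, gaussianPDFReal_mul_exp_sq]
  exact (integrable_exp_neg_mul_sq (by linarith)).const_mul _

lemma integral_exp_sq_stdNormal {s : ℝ} (hs : s ^ 2 < 1) :
    ∫ u, Real.exp ((s * u) ^ 2 / 2) ∂stdNormal = √((1 - s ^ 2)⁻¹) := by
  rw [integral_gaussianReal_eq_integral_smul one_ne_zero]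
  simp only [smul_eq_mul, gaussianPDFReal_mul_exp_sq]
  rw [integral_const_mul, integral_gaussian, ← Real.sqrt_inv, ← Real.sqrt_mul (by positivity)]
  congr 1
  have : 1 - s ^ 2 ≠ 0 := by linarith
  field_simp

/-- After squaring: `1 / (1 - a) = 1 + a / (1 - a) ≤ exp (a / (1 - a))`. -/
lemma sqrt_inv_one_sub_le {a : ℝ} (ha : a < 1) :
    √((1 - a)⁻¹) ≤ Real.exp (a / (2 * (1 - a))) := by
  have h1 : 0 < 1 - a := by linarith
  rw [Real.sqrt_le_left (Real.exp_pos _).le, ← Real.exp_nat_mul]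
  have h := Real.add_one_le_exp (a / (1 - a))
  calc (1 - a)⁻¹ = a / (1 - a) + 1 := by field_simp; ring
    _ ≤ _ := h
    _ = _ := by congr 1; push_cast; field_simp

lemma abs_overlapMoment_stdNormal_le {N d : ℕ} (hd : 0 < d) (hdN : d < N) :
    |overlapMoment (Measure.pi fun _ : Fin N => stdNormal) d|
      ≤ (√(d * N) / Real.exp 1) ^ d * 2 * Real.exp (1 / (2 * (1 - (d : ℝ) / N))) ^ d := by
  have hd' : (0 : ℝ) < d := by exact_mod_cast hd
  have hN : (0 : ℝ) < N := by exact_mod_cast hd.trans hdN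
  have hlt : (d : ℝ) / N < 1 := by rw [div_lt_one hN]; exact_mod_cast hdN
  -- With `s² = d / N`, the `N`-th power of `(1 - s²)^(-1/2)` is only exponential in `d`; `d < N`
  -- makes the Gaussian integral finite.
  set s : ℝ := √((d : ℝ) / N) with hs
  have hs0 : 0 < s := Real.sqrt_pos.2 (by positivity)
  have hs2 : s ^ 2 = (d : ℝ) / N := Real.sq_sqrt (by positivity)
  have hs1 : s ^ 2 < 1 := hs2 ▸ hlt
  have h := abs_overlapMoment_le (m := N) hd hs0 (μ := stdNormal)
    (hasAllMoments_gaussianReal 0 1) (M := fun c => Real.exp (c ^ 2 / 2))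
    (fun c => integrable_exp_mul_gaussianReal c)
    (fun c => by
      have := congrFun (mgf_id_gaussianReal (μ := 0) (v := 1)) c
      simpa [mgf] using this)
    (fun c => by simp) (integrable_exp_sq_stdNormal hs1)
  rw [integral_exp_sq_stdNormal hs1] at h
  refine h.trans ?_
  have e1 : (d : ℝ) / (Real.exp 1 * s) = √(d * N) / Real.exp 1 := by
    rw [hs, Real.sqrt_div hd'.le, Real.sqrt_mul hd'.le]
    have h1 : √(d : ℝ) ≠ 0 := (Real.sqrt_pos.2 hd').ne'
    have h2 : √(N : ℝ) ≠ 0 := (Real.sqrt_pos.2 hN).ne'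
    field_simp
    exact (Real.sq_sqrt hd'.le).symm
  rw [e1]
  refine mul_le_mul_of_nonneg_left ?_ (by positivity)
  refine (pow_le_pow_left₀ (Real.sqrt_nonneg _) (sqrt_inv_one_sub_le hs1) N).trans (le_of_eq ?_)
  rw [← Real.exp_nat_mul, ← Real.exp_nat_mul, hs2]
  congr 1
  field_simp

/-! ### The overlap of sparse Rademacher vectors -/

lemma isProbabilityMeasure_sparseRademacherEntry (n : ℕ) {ρ : ℝ} (h0 : 0 < ρ) (h1 : ρ ≤ 1) :
    IsProbabilityMeasure (sparseRademacherEntry n ρ) := by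
  constructor
  simp only [sparseRademacherEntry, Measure.coe_add, Measure.coe_smul, Pi.add_apply,
    Pi.smul_apply, measure_univ, smul_eq_mul, mul_one]
  rw [← ENNReal.ofReal_add (by linarith) (by linarith),
    ← ENNReal.ofReal_add (by linarith) (by linarith)]
  simp

lemma integrable_sparseRademacherEntry (n : ℕ) (ρ : ℝ) (f : ℝ → ℝ) :
    Integrable f (sparseRademacherEntry n ρ) := by
  have h : ∀ a : ℝ, Integrable f (Measure.dirac a) := fun a => integrable_dirac (by simp)
  exact (((h _).smul_measure (by simp)).add_measure ((h _).smul_measure (by simp))).add_measure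
    ((h _).smul_measure (by simp))

lemma integral_sparseRademacherEntry (n : ℕ) {ρ : ℝ} (h0 : 0 < ρ) (h1 : ρ ≤ 1) (f : ℝ → ℝ) :
    ∫ u, f u ∂(sparseRademacherEntry n ρ)
      = ρ / 2 * f (1 / √(ρ * n)) + ρ / 2 * f (-(1 / √(ρ * n))) + (1 - ρ) * f 0 := by
  have h : ∀ a : ℝ, Integrable f (Measure.dirac a) := fun a => integrable_dirac (by simp)
  rw [sparseRademacherEntry, integral_add_measure
    (((h _).smul_measure (by simp)).add_measure ((h _).smul_measure (by simp)))
    ((h _).smul_measure (by simp)), integral_add_measure ((h _).smul_measure (by simp))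
    ((h _).smul_measure (by simp))]
  simp only [integral_smul_measure, integral_dirac, smul_eq_mul]
  rw [ENNReal.toReal_ofReal (by linarith), ENNReal.toReal_ofReal (by linarith)]

lemma hasAllMoments_sparseRademacherEntry (n : ℕ) {ρ : ℝ} (h0 : 0 < ρ) (h1 : ρ ≤ 1) :
    HasAllMoments (fun u => u) (sparseRademacherEntry n ρ) := fun p => by
  have := isProbabilityMeasure_sparseRademacherEntry n h0 h1
  refine MemLp.of_bound (by fun_prop) (1 / √(ρ * n)) ?_
  simp only [sparseRademacherEntry, ae_add_measure_iff]
  have h : (0 : ℝ) ≤ 1 / √(ρ * n) := by positivity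
  refine ⟨⟨Measure.ae_smul_measure ?_ _, Measure.ae_smul_measure ?_ _⟩,
    Measure.ae_smul_measure ?_ _⟩ <;> rw [ae_dirac_eq]
  · simp [abs_of_nonneg (Real.sqrt_nonneg _)]
  · simp [abs_of_nonneg (Real.sqrt_nonneg _)]
  · simpa using h

lemma isProbabilityMeasure_sparseRademacher (n : ℕ) {ρ : ℝ} (h0 : 0 < ρ) (h1 : ρ ≤ 1) :
    IsProbabilityMeasure (sparseRademacher n ρ) := by
  have := isProbabilityMeasure_sparseRademacherEntry n h0 h1
  unfold sparseRademacher
  infer_instance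

lemma hasAllMoments_sparseRademacher (n : ℕ) {ρ : ℝ} (h0 : 0 < ρ) (h1 : ρ ≤ 1) (i : Fin n) :
    HasAllMoments (fun x : Fin n → ℝ => x i) (sparseRademacher n ρ) := by
  have := isProbabilityMeasure_sparseRademacherEntry n h0 h1
  exact (hasAllMoments_sparseRademacherEntry n h0 h1).comp
    (measurePreserving_eval (fun _ : Fin n => sparseRademacherEntry n ρ) i)

/-- Nonzero entries are `± 1 / √(ρ n)`, so with Chernoff parameter `t ρ n` the product of two of
them contributes `± t`. Both entries are nonzero with probability `ρ²`, and `1 + ρ² (cosh t - 1)` is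
bounded by its exponential. -/
lemma abs_overlapMoment_sparseRademacher_le {n d : ℕ} (hn : 0 < n) (hd : 0 < d) {ρ t : ℝ}
    (h0 : 0 < ρ) (h1 : ρ ≤ 1) (ht : 0 < t) :
    |overlapMoment (sparseRademacher n ρ) d|
      ≤ (d / (Real.exp 1 * (t * (ρ * n)))) ^ d * 2
        * Real.exp (ρ ^ 2 * n * (Real.cosh t - 1)) := by
  have := isProbabilityMeasure_sparseRademacherEntry n h0 h1
  have hn' : (0 : ℝ) < n := by exact_mod_cast hn
  set a : ℝ := 1 / √(ρ * n) with ha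
  have hρn : 0 < ρ * n := by positivity
  have ha2 : a * a = 1 / (ρ * n) := by
    rw [ha, div_mul_div_comm, Real.mul_self_sqrt hρn.le, one_mul]
  have h := abs_overlapMoment_le (m := n) hd (t := t * (ρ * n)) (by positivity)
    (hasAllMoments_sparseRademacherEntry n h0 h1)
    (M := fun c => 1 - ρ + ρ * Real.cosh (c * a))
    (fun c => integrable_sparseRademacherEntry _ _ _)
    (fun c => by
      rw [integral_sparseRademacherEntry n h0 h1, Real.cosh_eq]
      simp only [mul_zero, Real.exp_zero, mul_neg, ← ha]
      ring)
    (fun c => by simp only [neg_mul, Real.cosh_neg]) (integrable_sparseRademacherEntry _ _ _)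
  refine h.trans (mul_le_mul_of_nonneg_left ?_ (by positivity))
  have e1 : ∀ b : ℝ, b = a ∨ b = -a →
      Real.cosh (t * (ρ * n) * b * a) = Real.cosh t := fun b hb => by
    have : t * (ρ * n) * a * a = t := by
      rw [mul_assoc, ha2]
      field_simp
    rcases hb with rfl | rfl
    · rw [this]
    · rw [mul_neg, neg_mul, Real.cosh_neg, this]
  rw [integral_sparseRademacherEntry n h0 h1, ← ha, e1 a (Or.inl rfl), e1 (-a) (Or.inr rfl),
    show ρ ^ 2 * n * (Real.cosh t - 1) = n * (ρ ^ 2 * (Real.cosh t - 1)) by ring,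
    Real.exp_nat_mul]
  have h3 := Real.add_one_le_exp (ρ ^ 2 * (Real.cosh t - 1))
  have h4 := Real.one_le_cosh t
  simp only [zero_mul, mul_zero, Real.cosh_zero, mul_one, sub_add_cancel]
  refine pow_le_pow_left₀ ?_ ?_ n
  · have : 0 ≤ 1 - ρ := by linarith
    positivity
  · refine le_trans (le_of_eq ?_) h3
    ring

/-! ### Bounds for the contribution of each degree -/

/-- The contribution of degree `d` to the squared norm of the low-degree likelihood ratio. -/
def degreeTerm (n N : ℕ) (β ρ : ℝ) (d : ℕ) : ℝ :=
  β ^ d / d.factorial * (overlapMoment (sparseRademacher n ρ) d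
    * overlapMoment (Measure.pi fun _ : Fin N => stdNormal) d)

lemma snr_nonneg {n N : ℕ} {β : ℝ} (hβ : 0 ≤ β) : 0 ≤ snr n N β :=
  div_nonneg hβ (Real.sqrt_nonneg _)

lemma snr_sq_mul {n N : ℕ} {β : ℝ} (hn : 0 < n) (hN : 0 < N) :
    snr n N β ^ 2 * n = β ^ 2 * N := by
  have hn' : (0 : ℝ) < n := by exact_mod_cast hn
  have hN' : (0 : ℝ) < N := by exact_mod_cast hN
  rw [snr, div_pow, Real.sq_sqrt (by positivity)]
  field_simp

/-- Combines `1 / d! ≤ (e / d)^d` with the two Chernoff bounds, each of which brings a factor 2. The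
left side of `hq` is the square of the resulting ratio `r`. -/
lemma abs_degreeTerm_le {n N d : ℕ} {β ρ t : ℝ} (hn : 0 < n) (hd : 0 < d) (hdN : d < N)
    (hβ : 0 ≤ β) (h0 : 0 < ρ) (h1 : ρ ≤ 1) (ht : 0 < t) {R : ℝ} (hR : 0 ≤ R)
    (hq : snr n N β ^ 2 * d / (t ^ 2 * (ρ ^ 2 * n)) *
      Real.exp (1 / (1 - (d : ℝ) / N) - 2 + 2 * (ρ ^ 2 * n) * (Real.cosh t - 1) / d) ≤ R ^ 2) :
    |degreeTerm n N β ρ d| ≤ 4 * R ^ d := by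
  have hn' : (0 : ℝ) < n := by exact_mod_cast hn
  have hd' : (0 : ℝ) < d := by exact_mod_cast hd
  have hN : 0 < N := hd.trans hdN
  have hN' : (0 : ℝ) < N := by exact_mod_cast hN
  have hfac : β ^ d / d.factorial ≤ (β * (Real.exp 1 / d)) ^ d := by
    have := Real.pow_div_factorial_le_exp (d : ℝ) hd'.le d
    rw [mul_pow, div_pow, ← Real.exp_nat_mul, mul_one, div_eq_mul_inv]
    refine mul_le_mul_of_nonneg_left ?_ (by positivity)
    rw [le_div_iff₀ (by positivity), mul_comm, ← div_eq_mul_inv]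
    exact this
  set e1 := Real.exp (1 / (2 * (1 - (d : ℝ) / N))) with he1
  set e2 := Real.exp (ρ ^ 2 * n * (Real.cosh t - 1) / d) with he2
  have hG := abs_overlapMoment_stdNormal_le hd hdN
  have hX := abs_overlapMoment_sparseRademacher_le hn hd h0 h1 ht
  have he2' : Real.exp (ρ ^ 2 * n * (Real.cosh t - 1)) = e2 ^ d := by
    rw [he2, ← Real.exp_nat_mul]
    congr 1
    field_simp
  rw [he2'] at hX
  set r := β * √(d * N) / (Real.exp 1 * (t * (ρ * n))) * e1 * e2 with hr
  have hr0 : 0 ≤ r := by positivity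
  have hrR : r ≤ R := by
    refine (pow_le_pow_iff_left₀ hr0 hR two_ne_zero).1 ?_
    refine le_trans (le_of_eq ?_) hq
    -- The identity `β² N = λ² n` replaces `β` and `N` by the signal-to-noise ratio.
    have hb : (β * √(d * N) / (Real.exp 1 * (t * (ρ * n)))) ^ 2
        = snr n N β ^ 2 * d / (t ^ 2 * (ρ ^ 2 * n)) * Real.exp (-2) := by
      rw [div_pow, mul_pow, mul_pow, Real.sq_sqrt (by positivity), Real.exp_neg,
        show (2 : ℝ) = ((2 : ℕ) : ℝ) * 1 by norm_num, Real.exp_nat_mul]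
      have := snr_sq_mul (β := β) hn hN
      field_simp
      linear_combination -this
    have hee : (e1 * e2) ^ 2 = Real.exp (1 / (1 - (d : ℝ) / N)
        + 2 * (ρ ^ 2 * n) * (Real.cosh t - 1) / d) := by
      rw [he1, he2, ← Real.exp_add, ← Real.exp_nat_mul]
      congr 1
      have : (d : ℝ) / N < 1 := by rw [div_lt_one hN']; exact_mod_cast hdN
      have : 1 - (d : ℝ) / N ≠ 0 := by linarith
      generalize 1 - (d : ℝ) / N = z at this
      push_cast
      field_simp
    rw [hr, mul_assoc, mul_pow, hb, hee, mul_assoc, ← Real.exp_add]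
    congr 2
    ring
  calc |degreeTerm n N β ρ d|
      = β ^ d / d.factorial * (|overlapMoment (sparseRademacher n ρ) d|
        * |overlapMoment (Measure.pi fun _ : Fin N => stdNormal) d|) := by
        rw [degreeTerm, abs_mul, abs_mul, abs_of_nonneg (by positivity)]
    _ ≤ (β * (Real.exp 1 / d)) ^ d * (((d / (Real.exp 1 * (t * (ρ * n)))) ^ d * 2 * e2 ^ d)
        * ((√(d * N) / Real.exp 1) ^ d * 2 * e1 ^ d)) := by
        gcongr
    _ = 4 * r ^ d := by
        have : r = (β * (Real.exp 1 / d)) * (d / (Real.exp 1 * (t * (ρ * n)))) * e2 *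
            (√(d * N) / Real.exp 1) * e1 := by
          rw [hr]
          field_simp
        rw [this]
        simp only [mul_pow]
        ring
    _ ≤ 4 * R ^ d := by
        gcongr

/-- Averages the fourth-order Taylor bounds of `exp` at `± t`. Their remainder constant `5/96` is
relaxed to `1/12`, which later gives the 6 in the logarithmic sparsity condition. -/
lemma cosh_sub_one_le {t : ℝ} (ht : |t| ≤ 1) : Real.cosh t - 1 ≤ t ^ 2 / 2 + t ^ 4 / 12 := by
  have h1 := abs_le.1 (Real.exp_bound ht (n := 4) (by norm_num))
  have h2 := abs_le.1 (Real.exp_bound (x := -t) (by rwa [abs_neg]) (n := 4) (by norm_num))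
  simp only [Finset.sum_range_succ, Finset.sum_range_zero, Nat.factorial, abs_neg,
    show |t| ^ 4 = t ^ 4 by rw [← abs_pow, abs_of_nonneg (by positivity)]] at h1 h2
  norm_num at h1 h2
  rw [Real.cosh_eq]
  have : 0 ≤ t ^ 4 := by positivity
  nlinarith [h1.2, h2.2]

/-- Separates off zero signal, where `log (1 / λ)` and the choice of `t` proportional to `λ`
degenerate. -/
lemma degreeTerm_zero_snr {n N d : ℕ} {β ρ : ℝ} (hn : 0 < n) (hN : 0 < N) (hd : 0 < d)
    (h : snr n N β = 0) : degreeTerm n N β ρ d = 0 := by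
  have hN' : (N : ℝ) ≠ 0 := by exact_mod_cast hN.ne'
  have h1 := snr_sq_mul (β := β) hn hN
  rw [h] at h1
  have hβ : β = 0 := by simpa [hN'] using h1.symm
  simp [degreeTerm, hβ, hd.ne']

lemma inv_one_sub_div_le {d D N : ℕ} {ε : ℝ} (hdD : d ≤ D) (hDN : (D : ℝ) / N < 1)
    (hε : 1 / (1 - (D : ℝ) / N) - 1 ≤ ε) : 1 / (1 - (d : ℝ) / N) - 1 ≤ ε := by
  refine le_trans (sub_le_sub_right ?_ 1) hε
  have : (d : ℝ) / N ≤ (D : ℝ) / N := by gcongr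
  exact one_div_le_one_div_of_le (by linarith) (by linarith)

lemma lt_of_le_of_div_lt_one {d D N : ℕ} (hN : 0 < N) (hdD : d ≤ D)
    (hDN : (D : ℝ) / N < 1) : d < N := by
  rw [div_lt_one (by exact_mod_cast hN)] at hDN
  exact hdD.trans_lt (by exact_mod_cast hDN)

lemma abs_degreeTerm_le_of_lt_one {n N D d : ℕ} {β ρ ε : ℝ} (hn : 0 < n) (hN : 0 < N)
    (hd : 0 < d) (hdD : d ≤ D) (hDN : (D : ℝ) / N < 1) (hε : 1 / (1 - (D : ℝ) / N) - 1 ≤ ε)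
    (hβ : 0 ≤ β) (h0 : 0 < ρ) (h1 : ρ ≤ 1) (hlt : snr n N β < 1)
    (h : max 1 (√(1 / (6 * Real.log (1 / snr n N β)))) * √((D : ℝ) / n) ≤ ρ) :
    |degreeTerm n N β ρ d| ≤ 4 * √(snr n N β * Real.exp ε) ^ d := by
  set l := snr n N β with hl
  have hn' : (0 : ℝ) < n := by exact_mod_cast hn
  have hd' : (0 : ℝ) < d := by exact_mod_cast hd
  have hdD' : (d : ℝ) ≤ D := by exact_mod_cast hdD
  rcases (snr_nonneg hβ : 0 ≤ l).eq_or_lt with hl0 | hl0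
  · rw [degreeTerm_zero_snr hn hN hd hl0.symm, abs_zero]
    positivity
  have hlog : 0 < Real.log (1 / l) := Real.log_pos (by rw [lt_div_iff₀ hl0]; linarith)
  set m := ρ ^ 2 * n with hm
  have hm0 : 0 < m := by positivity
  -- The squared sparsity condition, used for both entries of the maximum: `c = 1` ensures `t ≤ 1`,
  -- and the square root controls the quartic term of `cosh`.
  have hDm : ∀ c : ℝ, 0 ≤ c → c ≤ max 1 (√(1 / (6 * Real.log (1 / l)))) → c ^ 2 * D ≤ m := by
    intro c hc hcm
    have h2 : c * √((D : ℝ) / n) ≤ ρ := (by gcongr : _ ≤ _).trans h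
    have h3 := pow_le_pow_left₀ (by positivity) h2 2
    rw [mul_pow, Real.sq_sqrt (by positivity), ← mul_div_assoc, div_le_iff₀ hn'] at h3
    exact h3
  have hD1 : (D : ℝ) ≤ m := by simpa using hDm 1 zero_le_one (le_max_left _ _)
  have hD2 : (D : ℝ) ≤ 6 * Real.log (1 / l) * m := by
    have := hDm _ (Real.sqrt_nonneg _) (le_max_right _ _)
    rwa [Real.sq_sqrt (by positivity), one_div, inv_mul_le_iff₀ (by positivity)] at this
  -- This choice minimises `exp(t² m / d) / t²`, that is, the bound with `cosh t - 1` replaced by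
  -- `t² / 2`.
  set t := √(d / m) with ht
  have ht0 : 0 < t := Real.sqrt_pos.2 (by positivity)
  have ht2 : t ^ 2 = d / m := Real.sq_sqrt (by positivity)
  have ht1 : |t| ≤ 1 := by
    rw [abs_of_pos ht0, ht, Real.sqrt_le_one, div_le_one hm0]
    linarith
  refine abs_degreeTerm_le hn hd (lt_of_le_of_div_lt_one hN hdD hDN) hβ h0 h1 ht0
    (Real.sqrt_nonneg _) ?_
  rw [← hl, ← hm, ht2, Real.sq_sqrt (by positivity), div_mul_cancel₀ _ hm0.ne',
    mul_div_cancel_right₀ _ hd'.ne']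
  have hc := cosh_sub_one_le ht1
  rw [show t ^ 4 = (t ^ 2) ^ 2 by ring, ht2] at hc
  have hc2 : 2 * m * (Real.cosh t - 1) / d ≤ 1 + Real.log (1 / l) := by
    calc 2 * m * (Real.cosh t - 1) / d ≤ 2 * m * (d / m / 2 + (d / m) ^ 2 / 12) / d := by gcongr
      _ = 1 + d / (6 * m) := by field_simp; ring
      _ ≤ 1 + Real.log (1 / l) := by
        gcongr
        rw [div_le_iff₀ (by positivity)]
        linarith
  have hε' := inv_one_sub_div_le hdD hDN hε
  calc l ^ 2 * Real.exp (1 / (1 - (d : ℝ) / N) - 2 + 2 * m * (Real.cosh t - 1) / d)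
      ≤ l ^ 2 * Real.exp (ε + Real.log (1 / l)) := by
        refine mul_le_mul_of_nonneg_left (Real.exp_le_exp.2 ?_) (by positivity)
        linarith
    _ = l * Real.exp ε := by
        rw [Real.exp_add, Real.exp_log (by positivity)]
        field_simp

lemma abs_degreeTerm_le_of_lt_inv_sqrt_three {n N D d : ℕ} {β ρ ε : ℝ} (hn : 0 < n) (hN : 0 < N)
    (hd : 0 < d) (hdD : d ≤ D) (hDN : (D : ℝ) / N < 1) (hε : 1 / (1 - (D : ℝ) / N) - 1 ≤ ε)
    (hβ : 0 ≤ β) (h0 : 0 < ρ) (h1 : ρ ≤ 1) (hlt : snr n N β < 1 / √3)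
    (h : snr n N β * √((D : ℝ) / n) ≤ ρ) :
    |degreeTerm n N β ρ d| ≤ 4 * √(Real.exp (-(1 / 2) + ε)) ^ d := by
  set l := snr n N β with hl
  have hn' : (0 : ℝ) < n := by exact_mod_cast hn
  have hd' : (0 : ℝ) < d := by exact_mod_cast hd
  have hdD' : (d : ℝ) ≤ D := by exact_mod_cast hdD
  rcases (snr_nonneg hβ : 0 ≤ l).eq_or_lt with hl0 | hl0
  · rw [degreeTerm_zero_snr hn hN hd hl0.symm, abs_zero]
    positivity
  have hl3 : l ^ 2 ≤ 1 / 3 := by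
    have := pow_le_pow_left₀ hl0.le hlt.le 2
    rwa [div_pow, one_pow, Real.sq_sqrt (by norm_num)] at this
  set m := ρ ^ 2 * n with hm
  have hm0 : 0 < m := by positivity
  have hDm : l ^ 2 * D ≤ m := by
    have h3 := pow_le_pow_left₀ (by positivity) h 2
    rwa [mul_pow, Real.sq_sqrt (by positivity), ← mul_div_assoc, div_le_iff₀ hn'] at h3
  have hdm : l ^ 2 * d ≤ m := le_trans (by gcongr) hDm
  -- Chosen so that the prefactor `l² d / (t² m)` equals 1; the sparsity condition is exactly what
  -- gives `t ≤ 1`.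
  set t := √(l ^ 2 * d / m) with ht
  have ht0 : 0 < t := Real.sqrt_pos.2 (by positivity)
  have ht2 : t ^ 2 = l ^ 2 * d / m := Real.sq_sqrt (by positivity)
  have ht1 : |t| ≤ 1 := by
    rw [abs_of_pos ht0, ht, Real.sqrt_le_one, div_le_one hm0]
    exact hdm
  refine abs_degreeTerm_le hn hd (lt_of_le_of_div_lt_one hN hdD hDN) hβ h0 h1 ht0
    (Real.sqrt_nonneg _) ?_
  rw [← hl, ← hm, ht2, Real.sq_sqrt (by positivity), div_mul_cancel₀ _ hm0.ne',
    div_self (by positivity), one_mul, Real.exp_le_exp]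
  have hc := cosh_sub_one_le ht1
  rw [show t ^ 4 = (t ^ 2) ^ 2 by ring, ht2] at hc
  -- Since `l² ≤ 1/3`, the left side is at most `7/6 · 1/3 = 7/18`.
  have hc2 : 2 * m * (Real.cosh t - 1) / d ≤ 1 / 2 := by
    calc 2 * m * (Real.cosh t - 1) / d
        ≤ 2 * m * (l ^ 2 * d / m / 2 + (l ^ 2 * d / m) ^ 2 / 12) / d := by gcongr
      _ = l ^ 2 + l ^ 2 * (l ^ 2 * d / m) / 6 := by field_simp; ring
      _ ≤ l ^ 2 + l ^ 2 * 1 / 6 := by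
        gcongr
        rw [div_le_one hm0]
        exact hdm
      _ ≤ 1 / 2 := by linarith
  have hε' := inv_one_sub_div_le hdD hDN hε
  linarith

/-! ### Boundedness of the norm -/

/-- Degree zero contributes 1, which is below `4 q^0`, so the whole sum is dominated by a geometric
series independent of `D`. -/
lemma lowDegreeLRNorm_le {n N D : ℕ} {β ρ q : ℝ} (hβ : 0 ≤ β) (h0 : 0 < ρ) (h1 : ρ ≤ 1)
    (hq0 : 0 ≤ q) (hq1 : q < 1)
    (h : ∀ d, 0 < d → d ≤ D → |degreeTerm n N β ρ d| ≤ 4 * q ^ d) :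
    lowDegreeLRNorm n N β (sparseRademacher n ρ) D ≤ √(4 * (1 - q)⁻¹) := by
  have := isProbabilityMeasure_sparseRademacher n h0 h1
  rw [lowDegreeLRNorm, integral_lowDegreeLR_sq_eq_sum hβ (hasAllMoments_sparseRademacher n h0 h1)]
  refine Real.sqrt_le_sqrt ?_
  calc ∑ d ∈ Finset.range (D + 1), degreeTerm n N β ρ d
      ≤ ∑ d ∈ Finset.range (D + 1), 4 * q ^ d := by
        refine Finset.sum_le_sum fun d hd => ?_
        rcases Nat.eq_zero_or_pos d with rfl | hd0
        · simp [degreeTerm, overlapMoment_zero]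
        · exact (le_abs_self _).trans (h d hd0 (Nat.lt_succ_iff.1 (Finset.mem_range.1 hd)))
    _ ≤ 4 * (1 - q)⁻¹ := by
        rw [← Finset.mul_sum, ← tsum_geometric_of_lt_one hq0 hq1]
        gcongr
        exact (summable_geometric_of_lt_one hq0 hq1).sum_le_tsum _ fun _ _ => by positivity

lemma exists_eventually_lt_of_limsup_lt {u : ℕ → ℝ} {a : ℝ}
    (h : limsup (fun n => (u n : EReal)) atTop < (a : EReal)) :
    ∃ r < a, ∀ᶠ n in atTop, u n < r := by
  obtain ⟨r, hr1, hr2⟩ := EReal.lt_iff_exists_real_btwn.1 h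
  exact ⟨r, by exact_mod_cast hr2, (eventually_lt_of_limsup_lt hr1).mono fun n hn => by
    exact_mod_cast hn⟩

/-- `D / N = (D / n) (n / N)` is `o(1) · O(1)`. This is where boundedness of `γ` enters. -/
lemma tendsto_degree_div_samples {N D : ℕ → ℕ}
    (hγ : (fun n : ℕ => (n : ℝ) / N n) =O[atTop] (fun _ => (1 : ℝ)))
    (hD : (fun n : ℕ => (D n : ℝ)) =o[atTop] (fun n : ℕ => (n : ℝ))) :
    Tendsto (fun n => (D n : ℝ) / N n) atTop (nhds 0) := by
  have h1 := (isLittleO_one_iff ℝ).2 hD.tendsto_div_nhds_zero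
  have h2 := h1.mul_isBigO hγ
  simp only [mul_one] at h2
  refine ((isLittleO_one_iff ℝ).1 h2).congr' ?_
  filter_upwards [eventually_gt_atTop 0] with n hn
  have : (n : ℝ) ≠ 0 := by exact_mod_cast hn.ne'
  field_simp

end SparsePCA

end

/-! ### Uniform geometric ratio and conclusion -/

theorem mainTheorem2
    (N D : ℕ → ℕ) (β ρ : ℕ → ℝ)
    (hN : ∀ n, 0 < n → 0 < N n)
    (hβ : ∀ n, 0 < n → 0 ≤ β n)
    (hρ : ∀ n, 0 < n → 0 < ρ n ∧ ρ n ≤ 1)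
    (hγ : (fun n : ℕ => (n : ℝ) / N n) =O[atTop] (fun _ => (1 : ℝ)))
    (hD : (fun n : ℕ => (D n : ℝ)) =o[atTop] (fun n : ℕ => (n : ℝ)))
    (h :
      (limsup (fun n : ℕ => (SparsePCA.snr n (N n) (β n) : EReal)) atTop < 1 ∧
        ∀ᶠ n : ℕ in atTop,
          max 1 (√(1 / (6 * Real.log (1 / SparsePCA.snr n (N n) (β n))))) * √((D n : ℝ) / n)
            ≤ ρ n) ∨
      (limsup (fun n : ℕ => (SparsePCA.snr n (N n) (β n) : EReal)) atTop
          < ((1 / √3 : ℝ) : EReal) ∧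
        ∀ᶠ n : ℕ in atTop, SparsePCA.snr n (N n) (β n) * √((D n : ℝ) / n) ≤ ρ n)) :
    (∀ n, 0 < n →
      SparsePCA.wishartPlanted n (N n) (β n) (SparsePCA.sparseRademacher n (ρ n))
          ≪ SparsePCA.wishartNull n (N n) ∧
      SparsePCA.IsOrthogonalProjection (SparsePCA.wishartNull n (N n))
        (SparsePCA.polysOfDegreeLE n (N n) (D n))
        (SparsePCA.likelihoodRatio n (N n) (β n) (SparsePCA.sparseRademacher n (ρ n)))
        (SparsePCA.lowDegreeLR n (N n) (β n) (SparsePCA.sparseRademacher n (ρ n)) (D n))) ∧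
    (fun n : ℕ =>
      SparsePCA.lowDegreeLRNorm n (N n) (β n) (SparsePCA.sparseRademacher n (ρ n)) (D n))
        =O[atTop] (fun _ => (1 : ℝ)) := by
  refine ⟨fun n hn => ?_, ?_⟩
  · obtain ⟨h0, h1⟩ := hρ n hn
    have := SparsePCA.isProbabilityMeasure_sparseRademacher n h0 h1
    exact ⟨SparsePCA.wishartPlanted_absolutelyContinuous (hβ n hn) _,
      SparsePCA.isOrthogonalProjection_lowDegreeLR (hβ n hn)
        (SparsePCA.hasAllMoments_sparseRademacher n h0 h1)⟩
  have hδ := SparsePCA.tendsto_degree_div_samples hγ hD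
  have hlt : ∀ᶠ n in atTop, (D n : ℝ) / N n < 1 := hδ.eventually_lt_const one_pos
  have hε : ∀ ε : ℝ, 0 < ε → ∀ᶠ n in atTop, 1 / (1 - (D n : ℝ) / N n) - 1 ≤ ε := by
    intro ε hε
    have : Tendsto (fun n => 1 / (1 - (D n : ℝ) / N n) - 1) atTop (nhds (1 / (1 - 0) - 1)) :=
      (tendsto_const_nhds.div (tendsto_const_nhds.sub hδ) (by norm_num)).sub_const 1
    rw [sub_zero, div_one, sub_self] at this
    exact (this.eventually_lt_const hε).mono fun n hn => hn.le
  obtain ⟨q, hq0, hq1, hq⟩ : ∃ q : ℝ, 0 ≤ q ∧ q < 1 ∧ ∀ᶠ n in atTop, ∀ d, 0 < d → d ≤ D n →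
      |SparsePCA.degreeTerm n (N n) (β n) (ρ n) d| ≤ 4 * q ^ d := by
    rcases h with ⟨hsup, hb⟩ | ⟨hsup, hb⟩
    · obtain ⟨r', hr', hev'⟩ := SparsePCA.exists_eventually_lt_of_limsup_lt
        (a := 1) (by exact_mod_cast hsup)
      -- The maximum with `1/2` only makes `r` positive, so that `log (1 / r)` can be used.
      obtain ⟨r, hr, hr1, hev⟩ : ∃ r : ℝ, 0 < r ∧ r < 1 ∧
          ∀ᶠ n in atTop, SparsePCA.snr n (N n) (β n) < r :=
        ⟨max r' (1 / 2), by positivity, max_lt hr' (by norm_num),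
          hev'.mono fun n hn => hn.trans_le (le_max_left _ _)⟩
      have hlog : 0 < Real.log (1 / r) := Real.log_pos (by rw [lt_div_iff₀ hr]; linarith)
      -- With `ε = log (1 / r) / 2`, the squared ratio `λ exp ε` is at most `r · r^(-1/2) = √r`:
      -- half of the gap below 1 pays for `D / N`.
      refine ⟨√(√r), Real.sqrt_nonneg _, ?_, ?_⟩
      · rw [Real.sqrt_lt' one_pos, one_pow, Real.sqrt_lt' one_pos, one_pow]
        exact hr1
      filter_upwards [hev, hb, hlt, hε _ (half_pos hlog), eventually_gt_atTop 0]
        with n h1 h2 h3 h4 hn d hd hdD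
      refine (SparsePCA.abs_degreeTerm_le_of_lt_one hn (hN n hn) hd hdD h3 h4 (hβ n hn)
        (hρ n hn).1 (hρ n hn).2 (h1.trans hr1) h2).trans ?_
      have he : Real.exp (Real.log (1 / r) / 2) = √(1 / r) := by
        rw [Real.exp_half, Real.exp_log (by positivity)]
      gcongr
      calc SparsePCA.snr n (N n) (β n) * Real.exp (Real.log (1 / r) / 2)
          ≤ r * Real.exp (Real.log (1 / r) / 2) := by gcongr
        _ = √r := by
          rw [he, one_div, Real.sqrt_inv, ← div_eq_mul_inv, Real.div_sqrt]
    · obtain ⟨r, hr, hev⟩ := SparsePCA.exists_eventually_lt_of_limsup_lt hsup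
      -- Any `ε < 1/2` keeps the exponent negative; `1/4` is used.
      refine ⟨√(Real.exp (-(1 / 2) + 1 / 4)), Real.sqrt_nonneg _, ?_, ?_⟩
      · rw [Real.sqrt_lt' one_pos, one_pow, Real.exp_lt_one_iff]
        norm_num
      filter_upwards [hev, hb, hlt, hε (1 / 4) (by norm_num), eventually_gt_atTop 0]
        with n h1 h2 h3 h4 hn d hd hdD
      exact SparsePCA.abs_degreeTerm_le_of_lt_inv_sqrt_three hn (hN n hn) hd hdD h3 h4 (hβ n hn)
        (hρ n hn).1 (hρ n hn).2 (h1.trans hr) h2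
  refine IsBigO.of_bound (√(4 * (1 - q)⁻¹)) ?_
  filter_upwards [hq, eventually_gt_atTop 0] with n hn hn0
  rw [norm_one, mul_one, SparsePCA.lowDegreeLRNorm, Real.norm_of_nonneg (Real.sqrt_nonneg _)]
  exact SparsePCA.lowDegreeLRNorm_le (hβ n hn0) (hρ n hn0).1 (hρ n hn0).2 hq0 hq1 hn
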